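/- **Theorem 3.1.** Let $\mathscr X$ be a (real or complex) Banach space, let $A:\mathbb R\to\mathscr B(\mathscr X)$ and $F:\mathscr X\times\mathbb R\to\mathscr X$. *Conventions.* All integrals are Kurzweil integrals: for $a\le b$, $J=\int_a^b DU(\tau,s)$ means that for every $\epsilon>0$ there is a gauge $\gamma:[a,b]\to(0,\infty)$ such that $\big\|\sum_j[U(\tau_j,s_j)-U(\tau_j,s_{j-1})]-J\big\|<\epsilon$ for every tagged division $a=s_0\le\dots\le s_n=b$, $\tau_j\in[s_{j-1},s_j]$, with $[s_{j-1},s_j]\subset(\tau_j-\gamma(\tau_j),\tau_j+\gamma(\tau_j))$ for all $j$; $\int_a^b=-\int_b^a$ for $b<a$; $\int_a^b d_\sigma[W(\sigma)]g(\sigma)$ is the case $U(\tau,s)=W(s)g(\tau)$; and $\int_{-\infty}^t=\lim_{\eta\to-\infty}\int_\eta^t$, $\int_t^{\infty}=\lim_{\eta\to\infty}\int_t^\eta$. A solution of $\frac{dx}{d\tau}=D[A(t)x+F(x,t)]$ is a function $x:\mathbb R\to\mathscr X$ with $x(b)-x(a)=\int_a^b D[A(s)x(\tau)+F(x(\tau),s)]$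 for all $a,b\in\mathbb R$. The fundamental operator $V(t,s)$ of $\frac{dx}{d\tau}=D[A(t)x]$ is given by $V(t,s)=I+\int_s^t d[A(r)]V(r,s)$, with $V(\cdot,s)$ of locally bounded variation; $\mathscr V(t):=V(t,0)$ and $\mathscr V^{-1}(t):=V(0,t)$. *Assumptions.* (A1) The linear equation has an exponential dichotomy: there are a bounded projection $P$ on $\mathscr X$ and constants $K,\alpha>0$ with $\|\mathscr V(t)P\mathscr V^{-1}(s)\|\le Ke^{-\alpha(t-s)}$ for $t\ge s$ and $\|\mathscr V(t)(I-P)\mathscr V^{-1}(s)\|\le Ke^{\alpha(t-s)}$ for $t<s$. (A2) $V_A:=\sup\{\mathrm{var}_a^b A: a<b\le a+1\}<\infty$ (in particular this holds if $A$ has bounded variation on $\mathbb R$), and there is $C>0$ such that for all $t$ the operators $I-[A(t)-A(t^-)]$ and $I+[A(t^+)-A(t)]$ are invertible in $\mathscr B(\mathscr X)$ with inverses of norm at most $C$. (A3) There is a nondecreasing $h:\mathbb R\to\mathbb R$ with $V_h:=\sup\{\mathrm{var}_a^b h:a<b\}<\infty$ such that, for all $x,z\in\mathscr X$ and $t_1,t_2\in\mathbb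 R$, $\|F(x,t_2)-F(x,t_1)\|\le|h(t_2)-h(t_1)|$ and $\|F(x,t_2)-F(x,t_1)-F(z,t_2)+F(z,t_1)\|\le\|x-z\|\,|h(t_2)-h(t_1)|$. *Conclusion.* There is $\delta>0$, depending only on $K,\alpha,C$ and the bound for $V_A$, such that whenever $V_h\le\delta$ the equation $\frac{dx}{d\tau}=D[A(t)x+F(x,t)]$ has exactly one bounded solution $x:\mathbb R\to\mathscr X$. Moreover, a bounded function $x:\mathbb R\to\mathscr X$ is a solution if and only if, for every $t\in\mathbb R$, the following integrals exist and $$x(t)=\int_0^t DF(x(\tau),s)-\int_{-\infty}^t d_\sigma[\mathscr V(t)P\mathscr V^{-1}(\sigma)]\int_0^\sigma DF(x(\tau),s)+\int_t^\infty d_\sigma[\mathscr V(t)(I-P)\mathscr V^{-1}(\sigma)]\int_0^\sigma DF(x(\tau),s).$$ -/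

import Mathlib

open Set Filter Topology
open scoped NNReal ENNReal

/-- A tagged division `a = s₀ ≤ s₁ ≤ ⋯ ≤ sₙ = b` of `[a, b]` with tags `τⱼ ∈ [sⱼ, sⱼ₊₁]`, `j < n`.
The values of `pt` beyond `n` and of `tag` from `n` on are irrelevant. -/
structure TaggedDivision (a b : ℝ) where
  n : ℕ
  pt : ℕ → ℝ
  tag : ℕ → ℝ
  pt_zero : pt 0 = a
  pt_last : pt n = b
  pt_le_tag : ∀ j < n, pt j ≤ tag j
  tag_le_pt : ∀ j < n, tag j ≤ pt (j + 1)

/-- `D` is fine for the gauge `γ`: each `[sⱼ, sⱼ₊₁]` lies in `(τⱼ - γ(τⱼ), τⱼ + γ(τⱼ))`. -/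
def TaggedDivision.IsFine {a b : ℝ} (D : TaggedDivision a b) (γ : ℝ → ℝ) : Prop :=
  ∀ j < D.n, Icc (D.pt j) (D.pt (j + 1)) ⊆ Ioo (D.tag j - γ (D.tag j)) (D.tag j + γ (D.tag j))

/-- The sum `∑ⱼ [U(τⱼ, sⱼ₊₁) - U(τⱼ, sⱼ)]`. -/
def TaggedDivision.sum {E : Type*} [AddCommGroup E] {a b : ℝ} (D : TaggedDivision a b)
    (U : ℝ → ℝ → E) : E :=
  ∑ j ∈ Finset.range D.n, (U (D.tag j) (D.pt (j + 1)) - U (D.tag j) (D.pt j))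

/-- For `a ≤ b`: `U` is Kurzweil integrable on `[a, b]` and `J = ∫_a^b DU(τ, s)`. -/
def HasKurzweilIntegralOn {E : Type*} [NormedAddCommGroup E] (U : ℝ → ℝ → E) (a b : ℝ) (J : E) :
    Prop :=
  ∀ ε > 0, ∃ γ : ℝ → ℝ, (∀ t ∈ Icc a b, 0 < γ t) ∧
    ∀ D : TaggedDivision a b, D.IsFine γ → ‖D.sum U - J‖ < ε

/-- The oriented Kurzweil integral exists and `J = ∫_a^b DU(τ, s)`, where
`∫_a^b = -∫_b^a` for `b < a`. -/
def HasKurzweilIntegral {E : Type*} [NormedAddCommGroup E] (U : ℝ → ℝ → E) (a b : ℝ) (J : E) :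
    Prop :=
  (a ≤ b → HasKurzweilIntegralOn U a b J) ∧ (b < a → HasKurzweilIntegralOn U b a (-J))

section Banach

variable {𝕜 : Type*} [RCLike 𝕜] {X : Type*} [NormedAddCommGroup X] [NormedSpace 𝕜 X]

/-- The Perron–Stieltjes integral exists and `J = ∫_a^b d[W(σ)] g(σ)`; its sums are
`∑ⱼ [W(sⱼ₊₁) - W(sⱼ)] g(τⱼ)`. -/
def HasStieltjesIntegral (W : ℝ → X →L[𝕜] X) (g : ℝ → X) (a b : ℝ) (J : X) : Prop :=
  HasKurzweilIntegral (fun τ s => W s (g τ)) a b J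

/-- The improper integral `J = ∫_{-∞}^t d[W(σ)] g(σ) = lim_{η → -∞} ∫_η^t d[W(σ)] g(σ)`. -/
def HasStieltjesIntegralAtBot (W : ℝ → X →L[𝕜] X) (g : ℝ → X) (t : ℝ) (J : X) : Prop :=
  ∃ I : ℝ → X, (∀ η ≤ t, HasStieltjesIntegral W g η t (I η)) ∧ Tendsto I atBot (𝓝 J)

/-- The improper integral `J = ∫_t^∞ d[W(σ)] g(σ) = lim_{η → ∞} ∫_t^η d[W(σ)] g(σ)`. -/
def HasStieltjesIntegralAtTop (W : ℝ → X →L[𝕜] X) (g : ℝ → X) (t : ℝ) (J : X) : Prop :=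
  ∃ I : ℝ → X, (∀ η ≥ t, HasStieltjesIntegral W g t η (I η)) ∧ Tendsto I atTop (𝓝 J)

/-- `V` is the fundamental operator of `dx/dτ = D[A(t)x]`:
`V(t, s) = I + ∫_s^t d[A(r)] V(r, s)`, an integral in the space of bounded operators, and
`V(·, s)` is of locally bounded variation. -/
structure IsFundamentalOperator (A : ℝ → X →L[𝕜] X) (V : ℝ → ℝ → X →L[𝕜] X) : Prop where
  integral_eq : ∀ t s : ℝ, HasKurzweilIntegral (fun τ r => (A r).comp (V τ s)) s t
    (V t s - ContinuousLinearMap.id 𝕜 X)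
  locallyBV : ∀ s : ℝ, LocallyBoundedVariationOn (fun t => V t s) univ

/-- The linear equation `dx/dτ = D[A(t)x]` with fundamental operator `V` has an exponential
dichotomy on `ℝ` with projection `P` and constants `K`, `α`.
Here `𝒱(t) = V(t, 0)` and `𝒱⁻¹(s) = V(0, s)`. -/
structure HasExponentialDichotomy (A : ℝ → X →L[𝕜] X) (V : ℝ → ℝ → X →L[𝕜] X) (P : X →L[𝕜] X)
    (K α : ℝ) : Prop where
  fundamental : IsFundamentalOperator A V
  proj : P.comp P = P
  stable : ∀ t s : ℝ, s ≤ t →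
    ‖(V t 0).comp (P.comp (V 0 s))‖ ≤ K * Real.exp (-α * (t - s))
  unstable : ∀ t s : ℝ, t < s →
    ‖(V t 0).comp ((ContinuousLinearMap.id 𝕜 X - P).comp (V 0 s))‖ ≤ K * Real.exp (α * (t - s))

/-- For all `t`, the operators `I - [A(t) - A(t⁻)]` and `I + [A(t⁺) - A(t)]` have bounded
inverses, of norm at most `C`. -/
structure HasBoundedJumpInverses (A : ℝ → X →L[𝕜] X) (C : ℝ) : Prop where
  left_isUnit : ∀ t : ℝ, IsUnit (1 - (A t - Function.leftLim A t))
  left_le : ∀ t : ℝ, ‖Ring.inverse (1 - (A t - Function.leftLim A t))‖ ≤ C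
  right_isUnit : ∀ t : ℝ, IsUnit (1 + (Function.rightLim A t - A t))
  right_le : ∀ t : ℝ, ‖Ring.inverse (1 + (Function.rightLim A t - A t))‖ ≤ C

/-- The class `𝓕(X × ℝ, h)`, for a nondecreasing `h`. -/
structure IsInClassF (F : X → ℝ → X) (h : ℝ → ℝ) : Prop where
  mono : Monotone h
  bound : ∀ (x : X) (t₁ t₂ : ℝ), ‖F x t₂ - F x t₁‖ ≤ |h t₂ - h t₁|
  lipschitz : ∀ (x z : X) (t₁ t₂ : ℝ),
    ‖F x t₂ - F x t₁ - F z t₂ + F z t₁‖ ≤ ‖x - z‖ * |h t₂ - h t₁|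

/-- `x : ℝ → X` is a solution on `ℝ` of `dx/dτ = D[A(t)x + F(x, t)]`:
`x(b) - x(a) = ∫_a^b D[A(s)x(τ) + F(x(τ), s)]` for all `a`, `b`. -/
def IsGODESolution (A : ℝ → X →L[𝕜] X) (F : X → ℝ → X) (x : ℝ → X) : Prop :=
  ∀ a b : ℝ, HasKurzweilIntegral (fun τ s => A s (x τ) + F (x τ) s) a b (x b - x a)

/-- All integrals below exist, and for every `t`
`x(t) = ∫_0^t DF(x(τ), s) - ∫_{-∞}^t d_σ[𝒱(t) P 𝒱⁻¹(σ)] ∫_0^σ DF(x(τ), s)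
  + ∫_t^∞ d_σ[𝒱(t) (I - P) 𝒱⁻¹(σ)] ∫_0^σ DF(x(τ), s)`;
the function `g` is `σ ↦ ∫_0^σ DF(x(τ), s)`. -/
def SatisfiesBoundedFormula (V : ℝ → ℝ → X →L[𝕜] X) (P : X →L[𝕜] X) (F : X → ℝ → X)
    (x : ℝ → X) : Prop :=
  ∃ g : ℝ → X, (∀ σ : ℝ, HasKurzweilIntegral (fun τ s => F (x τ) s) 0 σ (g σ)) ∧
    ∀ t : ℝ, ∃ J₁ J₂ : X,
      HasStieltjesIntegralAtBot (fun σ => (V t 0).comp (P.comp (V 0 σ))) g t J₁ ∧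
      HasStieltjesIntegralAtTop
        (fun σ => (V t 0).comp ((ContinuousLinearMap.id 𝕜 X - P).comp (V 0 σ))) g t J₂ ∧
      x t = g t - J₁ + J₂

end Banach

/-- `sup {var_a^b g : a < b}`. -/
noncomputable def supVariation {E : Type*} [PseudoEMetricSpace E] (g : ℝ → E) : ℝ≥0∞ :=
  ⨆ (a : ℝ) (b : ℝ) (_ : a < b), eVariationOn g (Icc a b)

/-- `sup {var_a^b g : a < b ≤ a + 1}`. -/
noncomputable def unitVariation {E : Type*} [PseudoEMetricSpace E] (g : ℝ → E) : ℝ≥0∞ :=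
  ⨆ (a : ℝ) (b : ℝ) (_ : a < b ∧ b ≤ a + 1), eVariationOn g (Icc a b)

/-- Bounded variation on the whole line implies the uniform bound over unit intervals. -/
theorem unitVariation_le_supVariation {E : Type*} [PseudoEMetricSpace E] (g : ℝ → E) :
    unitVariation g ≤ supVariation g :=
  iSup_mono fun _ => iSup_mono fun _ => iSup_le fun h =>
    le_iSup (fun _ => eVariationOn g (Icc _ _)) h.1

/-! ### Induction over intervals -/

/-- Take the supremum of the points reached from `a`: the left neighbourhood there shows that it is
reached, the right one that it is `b`. This turns one-sided local statements into statements on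
compact intervals throughout. -/
theorem interval_induction {p : ℝ → ℝ → Prop}
    (glue : ∀ a b c, a < b → b < c → p a b → p b c → p a c)
    (loc : ∀ t, (∀ᶠ s in 𝓝[<] t, p s t) ∧ ∀ᶠ s in 𝓝[>] t, p t s) {a b : ℝ} (hab : a < b) :
    p a b := by
  let S : Set ℝ := {t | t ∈ Ioc a b ∧ p a t}
  obtain ⟨u, hu, hu'⟩ := (mem_nhdsGT_iff_exists_Ioo_subset).1 (loc a).2
  have hu : a < u := hu
  have hne : S.Nonempty := by
    refine ⟨min ((a + u) / 2) b, ⟨lt_min (by linarith) hab, min_le_right _ _⟩,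
      hu' ⟨lt_min (by linarith) hab, ?_⟩⟩
    exact lt_of_le_of_lt (min_le_left _ _) (by linarith)
  have hbdd : BddAbove S := ⟨b, fun t ht => ht.1.2⟩
  set T := sSup S with hT
  have haT : a < T := by
    obtain ⟨t, ht⟩ := hne
    exact ht.1.1.trans_le (le_csSup hbdd ht)
  have hTb : T ≤ b := csSup_le hne fun t ht => ht.1.2
  have hpT : p a T := by
    obtain ⟨l, hl, hl'⟩ := (mem_nhdsLT_iff_exists_Ioo_subset).1 (loc T).1
    have hl : l < T := hl
    obtain ⟨t, ht, hlt⟩ := exists_lt_of_lt_csSup hne hl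
    rcases (le_csSup hbdd ht).eq_or_lt with h | h
    · rw [hT, ← h]; exact ht.2
    · exact glue _ _ _ ht.1.1 h ht.2 (hl' ⟨hlt, h⟩)
  rcases hTb.eq_or_lt with h | h
  · rwa [← h]
  · exfalso
    obtain ⟨r, hr, hr'⟩ := (mem_nhdsGT_iff_exists_Ioo_subset).1 (loc T).2
    have hr : T < r := hr
    set c := min ((T + r) / 2) b
    have hc : T < c := lt_min (by linarith) h
    have : c ∈ S := ⟨⟨haT.trans hc, min_le_right _ _⟩, glue _ _ _ haT hc hpT
      (hr' ⟨hc, lt_of_le_of_lt (min_le_left _ _) (by linarith)⟩)⟩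
    exact absurd (le_csSup hbdd this) (not_le.2 hc)

/-! ### Tagged divisions and Cousin's lemma -/

namespace TaggedDivision

variable {a b c : ℝ}

theorem pt_le_pt (D : TaggedDivision a b) {i j : ℕ} (hij : i ≤ j) (hj : j ≤ D.n) :
    D.pt i ≤ D.pt j := by
  induction j, hij using Nat.le_induction with
  | base => exact le_rfl
  | succ k hk ih =>
    exact (ih (by omega)).trans ((D.pt_le_tag k (by omega)).trans (D.tag_le_pt k (by omega)))

theorem pt_mem (D : TaggedDivision a b) {i : ℕ} (hi : i ≤ D.n) : D.pt i ∈ Icc a b :=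
  ⟨D.pt_zero.symm.trans_le (D.pt_le_pt (Nat.zero_le i) hi),
    (D.pt_le_pt hi le_rfl).trans_eq D.pt_last⟩

/-- The division with the single tag `t`. -/
def single (a b t : ℝ) (h₁ : a ≤ t) (h₂ : t ≤ b) : TaggedDivision a b where
  n := 1
  pt j := if j = 0 then a else b
  tag _ := t
  pt_zero := by simp
  pt_last := by simp
  pt_le_tag j hj := by simp [Nat.lt_one_iff.1 hj, h₁]
  tag_le_pt j hj := by simp [h₂]

/-- Concatenation of divisions of adjacent intervals. -/
def append (D : TaggedDivision a b) (D' : TaggedDivision b c) : TaggedDivision a c where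
  n := D.n + D'.n
  pt j := if j ≤ D.n then D.pt j else D'.pt (j - D.n)
  tag j := if j < D.n then D.tag j else D'.tag (j - D.n)
  pt_zero := by simp [D.pt_zero]
  pt_last := by
    by_cases h : D'.n = 0
    · have h1 := D'.pt_zero
      have h2 := D'.pt_last
      rw [h] at h2
      simp [h, D.pt_last, ← h1, h2]
    · simp [h, D'.pt_last]
  pt_le_tag j hj := by
    by_cases h : j < D.n
    · simpa [h, h.le] using D.pt_le_tag j h
    · by_cases h' : j ≤ D.n
      · obtain rfl : j = D.n := by omega
        have := D'.pt_le_tag 0 (by omega)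
        simpa [D.pt_last, D'.pt_zero] using this
      · simpa [h, h'] using D'.pt_le_tag (j - D.n) (by omega)
  tag_le_pt j hj := by
    by_cases h : j < D.n
    · simpa [h, Nat.succ_le_iff.2 h] using D.tag_le_pt j h
    · have := D'.tag_le_pt (j - D.n) (by omega)
      have h' : ¬ j + 1 ≤ D.n := by omega
      simp only [h, h', if_false]
      rwa [show j + 1 - D.n = j - D.n + 1 by omega]

theorem append_pt_add (D : TaggedDivision a b) (D' : TaggedDivision b c) (j : ℕ) :
    (D.append D').pt (D.n + j) = D'.pt j := by
  by_cases h : j = 0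
  · subst h; simp [append, D.pt_last, D'.pt_zero]
  · simp [append, h]

theorem append_tag_add (D : TaggedDivision a b) (D' : TaggedDivision b c) (j : ℕ) :
    (D.append D').tag (D.n + j) = D'.tag j := by
  simp [append]

theorem append_pt_of_le (D : TaggedDivision a b) (D' : TaggedDivision b c) {j : ℕ} (h : j ≤ D.n) :
    (D.append D').pt j = D.pt j := by
  simp [append, h]

theorem append_tag_of_lt (D : TaggedDivision a b) (D' : TaggedDivision b c) {j : ℕ}
    (h : j < D.n) : (D.append D').tag j = D.tag j := by
  simp [append, h]

theorem sum_append {E : Type*} [AddCommGroup E] (D : TaggedDivision a b)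
    (D' : TaggedDivision b c) (U : ℝ → ℝ → E) : (D.append D').sum U = D.sum U + D'.sum U := by
  have hn : (D.append D').n = D.n + D'.n := rfl
  simp only [TaggedDivision.sum, hn, Finset.sum_range_add]
  congr 1
  · refine Finset.sum_congr rfl fun j hj => ?_
    rw [Finset.mem_range] at hj
    rw [append_tag_of_lt _ _ hj, append_pt_of_le _ _ hj.le, append_pt_of_le _ _ hj]
  · refine Finset.sum_congr rfl fun j _ => ?_
    rw [append_tag_add, append_pt_add, add_assoc, append_pt_add]

theorem IsFine.append {D : TaggedDivision a b} {D' : TaggedDivision b c} {γ : ℝ → ℝ}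
    (h : D.IsFine γ) (h' : D'.IsFine γ) : (D.append D').IsFine γ := by
  intro j hj
  have hn : (D.append D').n = D.n + D'.n := rfl
  rcases lt_or_ge j D.n with hlt | hge
  · rw [append_tag_of_lt _ _ hlt, append_pt_of_le _ _ hlt.le, append_pt_of_le _ _ hlt]
    exact h j hlt
  · obtain ⟨k, rfl⟩ := Nat.exists_eq_add_of_le hge
    rw [append_tag_add, append_pt_add, add_assoc, append_pt_add]
    exact h' k (by omega)

theorem IsFine.mono {D : TaggedDivision a b} {γ γ' : ℝ → ℝ} (h : D.IsFine γ)
    (hγ : ∀ t, γ t ≤ γ' t) : D.IsFine γ' := fun j hj =>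
  (h j hj).trans (Ioo_subset_Ioo (by linarith [hγ (D.tag j)]) (by linarith [hγ (D.tag j)]))

/-- Cousin's lemma. -/
theorem exists_isFine {γ : ℝ → ℝ} (hab : a ≤ b) (hγ : ∀ t ∈ Icc a b, 0 < γ t) :
    ∃ D : TaggedDivision a b, D.IsFine γ := by
  rcases hab.eq_or_lt with rfl | hlt
  · exact ⟨⟨0, fun _ => a, fun _ => a, rfl, rfl, by simp, by simp⟩, by intro j hj; simp at hj⟩
  refine interval_induction (p := fun c d => a ≤ c → d ≤ b → ∃ D : TaggedDivision c d, D.IsFine γ)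
    ?_ ?_ hlt le_rfl le_rfl
  · intro c d e hcd hde h1 h2 hac heb
    obtain ⟨D, hD⟩ := h1 hac (hde.le.trans heb)
    obtain ⟨D', hD'⟩ := h2 (hac.trans hcd.le) heb
    exact ⟨D.append D', hD.append hD'⟩
  · intro t
    constructor
    · by_cases ht : 0 < γ t
      · filter_upwards [Ioo_mem_nhdsLT (sub_lt_self t ht)] with s hs _ _
        refine ⟨single s t t hs.2.le le_rfl, fun j hj => ?_⟩
        obtain rfl : j = 0 := Nat.lt_one_iff.1 hj
        intro x hx
        simp only [single] at hx ⊢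
        simp at hx
        exact ⟨by linarith [hs.1], by linarith⟩
      · filter_upwards [self_mem_nhdsWithin] with s hs has htb
        exact absurd (hγ t ⟨has.trans (le_of_lt hs), htb⟩) ht
    · by_cases ht : 0 < γ t
      · filter_upwards [Ioo_mem_nhdsGT (lt_add_of_pos_right t ht)] with s hs _ _
        refine ⟨single t s t le_rfl hs.1.le, fun j hj => ?_⟩
        obtain rfl : j = 0 := Nat.lt_one_iff.1 hj
        intro x hx
        simp only [single] at hx ⊢
        simp at hx
        exact ⟨by linarith [hs.1], by linarith [hs.2]⟩
      · filter_upwards [self_mem_nhdsWithin] with s hs has htb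
        exact absurd (hγ t ⟨has, (le_of_lt hs).trans htb⟩) ht

end TaggedDivision

/-! ### Approximate primitives and the Kurzweil integral -/

section Primitive

variable {E : Type*} [NormedAddCommGroup E]

/-- The increments of `f` are dominated by those of the real function `v`. -/
def IncrLE (f : ℝ → E) (v : ℝ → ℝ) : Prop :=
  ∀ s t, s ≤ t → ‖f t - f s‖ ≤ v t - v s

/-- Near every tag, the increments of `Φ` on `[a, b]` differ from those of `U` by at most the
increments of `w`. -/
def IsApproxPrimitive (U : ℝ → ℝ → E) (Φ : ℝ → E) (w : ℝ → ℝ) (a b : ℝ) : Prop :=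
  (∀ τ ∈ Ioc a b, ∀ᶠ s in 𝓝[<] τ, ‖Φ τ - Φ s - (U τ τ - U τ s)‖ ≤ w τ - w s) ∧
  ∀ τ ∈ Ico a b, ∀ᶠ t in 𝓝[>] τ, ‖Φ t - Φ τ - (U τ t - U τ τ)‖ ≤ w t - w τ

/-- `Φ` is an indefinite Kurzweil integral of `U`. -/
def IsKurzweilPrimitive (U : ℝ → ℝ → E) (Φ : ℝ → E) : Prop :=
  ∀ a b, a ≤ b → ∀ ε > 0, ∃ w : ℝ → ℝ, w b - w a ≤ ε ∧ IsApproxPrimitive U Φ w a b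

variable {U U' : ℝ → ℝ → E} {Φ Φ' : ℝ → E} {w : ℝ → ℝ} {a b : ℝ}

theorem IsApproxPrimitive.mono (h : IsApproxPrimitive U Φ w a b) {c d : ℝ} (hc : a ≤ c)
    (hd : d ≤ b) : IsApproxPrimitive U Φ w c d :=
  ⟨fun τ hτ => h.1 τ ⟨hc.trans_lt hτ.1, hτ.2.trans hd⟩,
    fun τ hτ => h.2 τ ⟨hc.trans hτ.1, hτ.2.trans_le hd⟩⟩

/-- Each interval of a fine division is cut at its tag. The one-sided errors on the two pieces are
bounded by increments of `w`, which telescope. -/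
theorem IsApproxPrimitive.exists_gauge (h : IsApproxPrimitive U Φ w a b) :
    ∃ γ : ℝ → ℝ, (∀ t, 0 < γ t) ∧ ∀ D : TaggedDivision a b, D.IsFine γ →
      ‖D.sum U - (Φ b - Φ a)‖ ≤ w b - w a := by
  have h1 : ∀ τ, ∃ γ > 0, τ ∈ Ioc a b → ∀ s, τ - γ < s → s < τ →
      ‖Φ τ - Φ s - (U τ τ - U τ s)‖ ≤ w τ - w s := by
    intro τ
    by_cases hτ : τ ∈ Ioc a b
    · obtain ⟨l, hl, hl'⟩ := mem_nhdsLT_iff_exists_Ioo_subset.1 (h.1 τ hτ)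
      exact ⟨τ - l, sub_pos.2 hl, fun _ s hs hs' => hl' ⟨by linarith, hs'⟩⟩
    · exact ⟨1, one_pos, fun h => absurd h hτ⟩
  have h2 : ∀ τ, ∃ γ > 0, τ ∈ Ico a b → ∀ t, t < τ + γ → τ < t →
      ‖Φ t - Φ τ - (U τ t - U τ τ)‖ ≤ w t - w τ := by
    intro τ
    by_cases hτ : τ ∈ Ico a b
    · obtain ⟨l, hl, hl'⟩ := mem_nhdsGT_iff_exists_Ioo_subset.1 (h.2 τ hτ)
      exact ⟨l - τ, sub_pos.2 hl, fun _ s hs hs' => hl' ⟨hs', by linarith⟩⟩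
    · exact ⟨1, one_pos, fun h => absurd h hτ⟩
  choose γ₁ hγ₁ h1 using h1
  choose γ₂ hγ₂ h2 using h2
  refine ⟨fun t => min (γ₁ t) (γ₂ t), fun t => lt_min (hγ₁ t) (hγ₂ t), fun D hD => ?_⟩
  have hΦ : Φ b - Φ a = ∑ j ∈ Finset.range D.n, (Φ (D.pt (j + 1)) - Φ (D.pt j)) := by
    rw [Finset.sum_range_sub (fun j => Φ (D.pt j)), D.pt_zero, D.pt_last]
  have hw : w b - w a = ∑ j ∈ Finset.range D.n, (w (D.pt (j + 1)) - w (D.pt j)) := by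
    rw [Finset.sum_range_sub (fun j => w (D.pt j)), D.pt_zero, D.pt_last]
  rw [hΦ, hw, TaggedDivision.sum, ← Finset.sum_sub_distrib]
  refine norm_sum_le_of_le _ fun j hj => ?_
  rw [Finset.mem_range] at hj
  have m1 := D.pt_mem hj.le
  have m2 := D.pt_mem (Nat.succ_le_iff.2 hj)
  have hf := hD j hj
  have t1 := D.pt_le_tag j hj
  have t2 := D.tag_le_pt j hj
  set τ := D.tag j
  set s := D.pt j
  set t := D.pt (j + 1)
  have fs := hf (left_mem_Icc.2 (t1.trans t2))
  have ft := hf (right_mem_Icc.2 (t1.trans t2))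
  have e1 : ‖Φ τ - Φ s - (U τ τ - U τ s)‖ ≤ w τ - w s := by
    rcases t1.eq_or_lt with e | e
    · rw [e]; simp
    · exact h1 τ ⟨m1.1.trans_lt e, t2.trans m2.2⟩ s
        (by linarith [fs.1, min_le_left (γ₁ τ) (γ₂ τ)]) e
  have e2 : ‖Φ t - Φ τ - (U τ t - U τ τ)‖ ≤ w t - w τ := by
    rcases t2.eq_or_lt with e | e
    · rw [← e]; simp
    · exact h2 τ ⟨m1.1.trans t1, e.trans_le m2.2⟩ t
        (by linarith [ft.2, min_le_right (γ₁ τ) (γ₂ τ)]) e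
  calc ‖U τ t - U τ s - (Φ t - Φ s)‖
      = ‖(Φ τ - Φ s - (U τ τ - U τ s)) + (Φ t - Φ τ - (U τ t - U τ τ))‖ := by
        rw [← norm_neg]; congr 1; abel
    _ ≤ w t - w s := (norm_add_le _ _).trans (by linarith)

theorem HasKurzweilIntegralOn.norm_sub_le {J : E} (hJ : HasKurzweilIntegralOn U a b J)
    (hab : a ≤ b) (h : IsApproxPrimitive U Φ w a b) : ‖J - (Φ b - Φ a)‖ ≤ w b - w a := by
  refine le_of_forall_pos_le_add fun ε hε => ?_
  obtain ⟨γ, hγ, h1⟩ := hJ ε hε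
  obtain ⟨γ', hγ', h2⟩ := h.exists_gauge
  obtain ⟨D, hD⟩ := TaggedDivision.exists_isFine (γ := fun t => min (γ t) (γ' t)) hab
    fun t ht => lt_min (hγ t ht) (hγ' t)
  have d1 := h1 D (hD.mono fun t => min_le_left _ _)
  have d2 := h2 D (hD.mono fun t => min_le_right _ _)
  calc ‖J - (Φ b - Φ a)‖ = ‖(D.sum U - (Φ b - Φ a)) - (D.sum U - J)‖ := by congr 1; abel
    _ ≤ _ := (_root_.norm_sub_le _ _).trans (by linarith)

theorem HasKurzweilIntegralOn.unique {J J' : E} (hJ : HasKurzweilIntegralOn U a b J)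
    (hJ' : HasKurzweilIntegralOn U a b J') (hab : a ≤ b) : J = J' := by
  rw [← sub_eq_zero, ← norm_le_zero_iff]
  refine le_of_forall_pos_le_add fun ε hε => ?_
  obtain ⟨γ, hγ, h1⟩ := hJ (ε / 2) (by linarith)
  obtain ⟨γ', hγ', h2⟩ := hJ' (ε / 2) (by linarith)
  obtain ⟨D, hD⟩ := TaggedDivision.exists_isFine (γ := fun t => min (γ t) (γ' t)) hab
    fun t ht => lt_min (hγ t ht) (hγ' t ht)
  have d1 := h1 D (hD.mono fun t => min_le_left _ _)
  have d2 := h2 D (hD.mono fun t => min_le_right _ _)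
  calc ‖J - J'‖ = ‖(D.sum U - J') - (D.sum U - J)‖ := by congr 1; abel
    _ ≤ _ := (_root_.norm_sub_le _ _).trans (by linarith)

theorem HasKurzweilIntegral.unique {J J' : E} (hJ : HasKurzweilIntegral U a b J)
    (hJ' : HasKurzweilIntegral U a b J') : J = J' := by
  rcases le_or_gt a b with h | h
  · exact (hJ.1 h).unique (hJ'.1 h) h
  · exact neg_injective ((hJ.2 h).unique (hJ'.2 h) h.le)

theorem HasKurzweilIntegralOn.add_interval {c : ℝ} {J₁ J₂ J : E}
    (h₁ : HasKurzweilIntegralOn U a b J₁) (h₂ : HasKurzweilIntegralOn U b c J₂)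
    (h : HasKurzweilIntegralOn U a c J) (hab : a ≤ b) (hbc : b ≤ c) : J = J₁ + J₂ := by
  rw [← sub_eq_zero, ← norm_le_zero_iff]
  refine le_of_forall_pos_le_add fun ε hε => ?_
  obtain ⟨γ₁, hγ₁, h₁⟩ := h₁ (ε / 3) (by linarith)
  obtain ⟨γ₂, hγ₂, h₂⟩ := h₂ (ε / 3) (by linarith)
  obtain ⟨γ, hγ, h⟩ := h (ε / 3) (by linarith)
  obtain ⟨D, hD⟩ := TaggedDivision.exists_isFine (γ := fun t => min (γ₁ t) (γ t)) hab
    fun t ht => lt_min (hγ₁ t ht) (hγ t ⟨ht.1, ht.2.trans hbc⟩)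
  obtain ⟨D', hD'⟩ := TaggedDivision.exists_isFine (γ := fun t => min (γ₂ t) (γ t)) hbc
    fun t ht => lt_min (hγ₂ t ht) (hγ t ⟨hab.trans ht.1, ht.2⟩)
  have d1 := h₁ D (hD.mono fun t => min_le_left _ _)
  have d2 := h₂ D' (hD'.mono fun t => min_le_left _ _)
  have d3 := h (D.append D') ((hD.mono fun t => min_le_right _ _).append
    (hD'.mono fun t => min_le_right _ _))
  rw [D.sum_append] at d3
  calc ‖J - (J₁ + J₂)‖ = ‖(D.sum U - J₁) + (D'.sum U - J₂) - (D.sum U + D'.sum U - J)‖ := by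
        congr 1; abel
    _ ≤ 0 + ε := (_root_.norm_sub_le _ _).trans
        (by linarith [norm_add_le (D.sum U - J₁) (D'.sum U - J₂)])

theorem TaggedDivision.norm_sum_le {v : ℝ → ℝ} (hU : ∀ τ ∈ Icc a b, IncrLE (U τ) v)
    (D : TaggedDivision a b) : ‖D.sum U‖ ≤ v b - v a := by
  have hv : v b - v a = ∑ j ∈ Finset.range D.n, (v (D.pt (j + 1)) - v (D.pt j)) := by
    rw [Finset.sum_range_sub (fun j => v (D.pt j)), D.pt_zero, D.pt_last]
  rw [hv]
  refine norm_sum_le_of_le _ fun j hj => ?_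
  rw [Finset.mem_range] at hj
  have h₁ := D.pt_le_tag j hj
  have h₂ := D.tag_le_pt j hj
  exact hU _ ⟨(D.pt_mem hj.le).1.trans h₁, h₂.trans (D.pt_mem (Nat.succ_le_iff.2 hj)).2⟩ _ _
    (h₁.trans h₂)

theorem HasKurzweilIntegralOn.norm_le {v : ℝ → ℝ} {J : E} (hJ : HasKurzweilIntegralOn U a b J)
    (hab : a ≤ b) (hU : ∀ τ ∈ Icc a b, IncrLE (U τ) v) : ‖J‖ ≤ v b - v a := by
  refine le_of_forall_pos_le_add fun ε hε => ?_
  obtain ⟨γ, hγ, h1⟩ := hJ ε hε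
  obtain ⟨D, hD⟩ := TaggedDivision.exists_isFine hab hγ
  have d1 := h1 D hD
  have := D.norm_sum_le hU
  calc ‖J‖ = ‖D.sum U - (D.sum U - J)‖ := by congr 1; abel
    _ ≤ _ := (_root_.norm_sub_le _ _).trans (by linarith)

/-- An estimate of the difference of two integrals with a common end point, which does not
presuppose integrability on the remaining interval. -/
theorem HasKurzweilIntegralOn.norm_sub_le_of_left {v : ℝ → ℝ} {c : ℝ} {J J' : E}
    (hJ : HasKurzweilIntegralOn U a b J) (hJ' : HasKurzweilIntegralOn U a c J') (hab : a ≤ b)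
    (hbc : b ≤ c) (hU : ∀ τ, IncrLE (U τ) v) : ‖J' - J‖ ≤ v c - v b := by
  refine le_of_forall_pos_le_add fun ε hε => ?_
  obtain ⟨γ₁, hγ₁, h₁⟩ := hJ (ε / 2) (by linarith)
  obtain ⟨γ, hγ, h⟩ := hJ' (ε / 2) (by linarith)
  obtain ⟨D, hD⟩ := TaggedDivision.exists_isFine (γ := fun t => min (γ₁ t) (γ t)) hab
    fun t ht => lt_min (hγ₁ t ht) (hγ t ⟨ht.1, ht.2.trans hbc⟩)
  obtain ⟨D', hD'⟩ := TaggedDivision.exists_isFine (γ := γ) hbc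
    fun t ht => hγ t ⟨hab.trans ht.1, ht.2⟩
  have d1 := h₁ D (hD.mono fun t => min_le_left _ _)
  have d3 := h (D.append D') ((hD.mono fun t => min_le_right _ _).append hD')
  have d2 := D'.norm_sum_le fun τ _ => hU τ
  rw [D.sum_append] at d3
  calc ‖J' - J‖ = ‖D'.sum U + (D.sum U - J) - (D.sum U + D'.sum U - J')‖ := by congr 1; abel
    _ ≤ _ := (_root_.norm_sub_le _ _).trans (by linarith [norm_add_le (D'.sum U) (D.sum U - J)])

theorem HasKurzweilIntegralOn.norm_sub_le_of_right {v : ℝ → ℝ} {c : ℝ} {J J' : E}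
    (hJ : HasKurzweilIntegralOn U b c J) (hJ' : HasKurzweilIntegralOn U a c J') (hab : a ≤ b)
    (hbc : b ≤ c) (hU : ∀ τ, IncrLE (U τ) v) : ‖J' - J‖ ≤ v b - v a := by
  refine le_of_forall_pos_le_add fun ε hε => ?_
  obtain ⟨γ₁, hγ₁, h₁⟩ := hJ (ε / 2) (by linarith)
  obtain ⟨γ, hγ, h⟩ := hJ' (ε / 2) (by linarith)
  obtain ⟨D, hD⟩ := TaggedDivision.exists_isFine (γ := fun t => min (γ₁ t) (γ t)) hbc
    fun t ht => lt_min (hγ₁ t ht) (hγ t ⟨hab.trans ht.1, ht.2⟩)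
  obtain ⟨D', hD'⟩ := TaggedDivision.exists_isFine (γ := γ) hab
    fun t ht => hγ t ⟨ht.1, ht.2.trans hbc⟩
  have d1 := h₁ D (hD.mono fun t => min_le_left _ _)
  have d3 := h (D'.append D) (hD'.append (hD.mono fun t => min_le_right _ _))
  have d2 := D'.norm_sum_le fun τ _ => hU τ
  rw [D'.sum_append] at d3
  calc ‖J' - J‖ = ‖D'.sum U + (D.sum U - J) - (D'.sum U + D.sum U - J')‖ := by congr 1; abel
    _ ≤ _ := (_root_.norm_sub_le _ _).trans (by linarith [norm_add_le (D'.sum U) (D.sum U - J)])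

/-- Two approximate primitives are compared through a single sum that is fine for both gauges, so
their total increments are Cauchy as the error tends to zero. -/
theorem exists_hasKurzweilIntegralOn [CompleteSpace E] (hab : a ≤ b)
    (H : ∀ ε > 0, ∃ (Φ : ℝ → E) (w : ℝ → ℝ), w b - w a ≤ ε ∧ IsApproxPrimitive U Φ w a b) :
    ∃ J, HasKurzweilIntegralOn U a b J := by
  choose! Φ w hw hΦ using H
  have key : ∀ ε > 0, ∀ ε' > 0, ‖(Φ ε b - Φ ε a) - (Φ ε' b - Φ ε' a)‖ ≤ ε + ε' := by
    intro ε hε ε' hε'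
    obtain ⟨γ, hγ, h1⟩ := (hΦ ε hε).exists_gauge
    obtain ⟨γ', hγ', h2⟩ := (hΦ ε' hε').exists_gauge
    obtain ⟨D, hD⟩ := TaggedDivision.exists_isFine (γ := fun t => min (γ t) (γ' t)) hab
      fun t _ => lt_min (hγ t) (hγ' t)
    have d1 := h1 D (hD.mono fun t => min_le_left _ _)
    have d2 := h2 D (hD.mono fun t => min_le_right _ _)
    calc _ = ‖(D.sum U - (Φ ε' b - Φ ε' a)) - (D.sum U - (Φ ε b - Φ ε a))‖ := by congr 1; abel
      _ ≤ _ := (_root_.norm_sub_le _ _).trans (by linarith [hw ε hε, hw ε' hε'])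
  have hc : Cauchy (map (fun ε => Φ ε b - Φ ε a) (𝓝[>] (0 : ℝ))) := by
    rw [Metric.cauchy_iff]
    refine ⟨inferInstance, fun ε hε => ⟨_, image_mem_map
      (Ioo_mem_nhdsGT (show (0 : ℝ) < ε / 2 by linarith)), ?_⟩⟩
    rintro _ ⟨r, hr, rfl⟩ _ ⟨s, hs, rfl⟩
    rw [dist_eq_norm]
    exact (key r hr.1 s hs.1).trans_lt (by linarith [hr.2, hs.2])
  obtain ⟨J, hJ⟩ := cauchy_map_iff_exists_tendsto.1 hc
  refine ⟨J, fun ε hε => ?_⟩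
  have hε3 : 0 < ε / 3 := by linarith
  have hJ' : ‖(Φ (ε / 3) b - Φ (ε / 3) a) - J‖ ≤ ε / 3 := by
    refine le_of_tendsto_of_tendsto ((tendsto_const_nhds.sub hJ).norm)
      (show Tendsto (fun r : ℝ => ε / 3 + r) (𝓝[>] 0) (𝓝 (ε / 3)) from ?_) ?_
    · have : Tendsto (fun r : ℝ => ε / 3 + r) (𝓝 0) (𝓝 (ε / 3 + 0)) :=
        tendsto_const_nhds.add tendsto_id
      rw [add_zero] at this
      exact this.mono_left nhdsWithin_le_nhds
    · filter_upwards [self_mem_nhdsWithin] with r hr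
      exact key _ hε3 r hr
  obtain ⟨γ, hγ, h1⟩ := (hΦ _ hε3).exists_gauge
  refine ⟨γ, fun t _ => hγ t, fun D hD => ?_⟩
  calc ‖D.sum U - J‖ = ‖(D.sum U - (Φ (ε / 3) b - Φ (ε / 3) a))
        + ((Φ (ε / 3) b - Φ (ε / 3) a) - J)‖ := by congr 1; abel
    _ ≤ _ := norm_add_le _ _
    _ < ε := by linarith [h1 D hD, hw _ hε3]

/-- The integrals over all compact intervals are additive and therefore come from one function on
the line, normalised at 0. -/
theorem exists_isKurzweilPrimitive [CompleteSpace E]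
    (H : ∀ a b, a < b → ∀ ε > 0, ∃ (Φ : ℝ → E) (w : ℝ → ℝ), w b - w a ≤ ε ∧
      IsApproxPrimitive U Φ w a b) :
    ∃ Φ, Φ 0 = 0 ∧ IsKurzweilPrimitive U Φ := by
  have H' : ∀ a b, a ≤ b → ∀ ε > 0, ∃ (Φ : ℝ → E) (w : ℝ → ℝ), w b - w a ≤ ε ∧
      IsApproxPrimitive U Φ w a b := by
    intro a b hab ε hε
    rcases hab.eq_or_lt with rfl | h
    · exact ⟨0, 0, by simpa using hε.le, fun τ hτ => absurd (hτ.1.trans_le hτ.2) (lt_irrefl _),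
        fun τ hτ => absurd (hτ.1.trans_lt hτ.2) (lt_irrefl _)⟩
    · exact H a b h ε hε
  choose! J hJ using fun a b (hab : a ≤ b) => exists_hasKurzweilIntegralOn hab (H' a b hab)
  have hadd : ∀ {a b c}, a ≤ b → b ≤ c → J a c = J a b + J b c := fun {a b c} h₁ h₂ =>
    (hJ a b h₁).add_interval (hJ b c h₂) (hJ a c (h₁.trans h₂)) h₁ h₂
  let Φ : ℝ → E := fun t => if 0 ≤ t then J 0 t else -J t 0
  have hΦ : ∀ {s t}, s ≤ t → Φ t - Φ s = J s t := by
    intro s t hst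
    simp only [Φ]
    split_ifs with ht hs hs
    · rw [hadd hs hst]; abel
    · rw [hadd (not_le.1 hs).le ht]; abel
    · exact absurd (hs.trans hst) ht
    · rw [hadd hst (not_le.1 ht).le]; abel
  refine ⟨Φ, ?_, fun a b hab ε hε => ?_⟩
  · have := hadd (le_refl (0 : ℝ)) (le_refl 0)
    simpa [Φ] using this
  obtain ⟨Ψ, w, hw, hΨ⟩ := H' a b hab (ε / 2) (by linarith)
  have hle : ∀ {s t}, a ≤ s → s ≤ t → t ≤ b → ‖J s t - (Ψ t - Ψ s)‖ ≤ w t - w s :=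
    fun {s t} h1 h2 h3 => (hJ s t h2).norm_sub_le h2 (hΨ.mono h1 h3)
  -- One `w` pays for the defect of `Ψ` against `U`, the other for the distance from `Ψ` to the true
  -- integral.
  refine ⟨fun t => 2 * w t, by linarith, fun τ hτ => ?_, fun τ hτ => ?_⟩
  · filter_upwards [hΨ.1 τ hτ, Ioo_mem_nhdsLT hτ.1] with s h1 hs
    rw [hΦ hs.2.le]
    calc _ = ‖(J s τ - (Ψ τ - Ψ s)) + (Ψ τ - Ψ s - (U τ τ - U τ s))‖ := by congr 1; abel
      _ ≤ _ := (norm_add_le _ _).trans (by linarith [hle hs.1.le hs.2.le hτ.2])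
  · filter_upwards [hΨ.2 τ hτ, Ioo_mem_nhdsGT hτ.2] with s h1 hs
    rw [hΦ hs.1.le]
    calc _ = ‖(J τ s - (Ψ s - Ψ τ)) + (Ψ s - Ψ τ - (U τ s - U τ τ))‖ := by congr 1; abel
      _ ≤ _ := (norm_add_le _ _).trans (by linarith [hle hτ.1 hs.1.le hs.2.le])

namespace IsKurzweilPrimitive

theorem hasKurzweilIntegralOn (h : IsKurzweilPrimitive U Φ) (hab : a ≤ b) :
    HasKurzweilIntegralOn U a b (Φ b - Φ a) := by
  intro ε hε
  obtain ⟨w, hw, h'⟩ := h a b hab (ε / 2) (by linarith)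
  obtain ⟨γ, hγ, h''⟩ := h'.exists_gauge
  exact ⟨γ, fun t _ => hγ t, fun D hD => (h'' D hD).trans_lt (by linarith)⟩

theorem hasKurzweilIntegral (h : IsKurzweilPrimitive U Φ) (a b : ℝ) :
    HasKurzweilIntegral U a b (Φ b - Φ a) :=
  ⟨fun hab => h.hasKurzweilIntegralOn hab,
    fun hba => by rw [neg_sub]; exact h.hasKurzweilIntegralOn hba.le⟩

theorem of_sub_eq (h : IsKurzweilPrimitive U Φ) (he : ∀ s t, s ≤ t → Φ' t - Φ' s = Φ t - Φ s) :
    IsKurzweilPrimitive U Φ' := by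
  intro a b hab ε hε
  obtain ⟨w, hw, h1, h2⟩ := h a b hab ε hε
  refine ⟨w, hw, fun τ hτ => ?_, fun τ hτ => ?_⟩
  · filter_upwards [h1 τ hτ, self_mem_nhdsWithin] with s hs hlt
    rwa [he s τ (le_of_lt hlt)]
  · filter_upwards [h2 τ hτ, self_mem_nhdsWithin] with s hs hlt
    rwa [he τ s (le_of_lt hlt)]

theorem of_hasKurzweilIntegralOn (h : IsKurzweilPrimitive U Φ)
    (h' : ∀ a b, a ≤ b → HasKurzweilIntegralOn U a b (Φ' b - Φ' a)) : IsKurzweilPrimitive U Φ' :=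
  h.of_sub_eq fun s t hst => (h' s t hst).unique (h.hasKurzweilIntegralOn hst) hst

theorem add (h : IsKurzweilPrimitive U Φ) (h' : IsKurzweilPrimitive U' Φ') :
    IsKurzweilPrimitive (fun τ s => U τ s + U' τ s) (fun t => Φ t + Φ' t) := by
  intro a b hab ε hε
  obtain ⟨w, hw, h1, h2⟩ := h a b hab (ε / 2) (by linarith)
  obtain ⟨w', hw', h1', h2'⟩ := h' a b hab (ε / 2) (by linarith)
  refine ⟨fun t => w t + w' t, by linarith, fun τ hτ => ?_, fun τ hτ => ?_⟩
  · filter_upwards [h1 τ hτ, h1' τ hτ] with s hs hs'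
    calc _ = ‖(Φ τ - Φ s - (U τ τ - U τ s)) + (Φ' τ - Φ' s - (U' τ τ - U' τ s))‖ := by
          congr 1; abel
      _ ≤ _ := (norm_add_le _ _).trans (by linarith)
  · filter_upwards [h2 τ hτ, h2' τ hτ] with s hs hs'
    calc _ = ‖(Φ s - Φ τ - (U τ s - U τ τ)) + (Φ' s - Φ' τ - (U' τ s - U' τ τ))‖ := by
          congr 1; abel
      _ ≤ _ := (norm_add_le _ _).trans (by linarith)

theorem neg (h : IsKurzweilPrimitive U Φ) :
    IsKurzweilPrimitive (fun τ s => -U τ s) (fun t => -Φ t) := by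
  intro a b hab ε hε
  obtain ⟨w, hw, h1, h2⟩ := h a b hab ε hε
  refine ⟨w, hw, fun τ hτ => ?_, fun τ hτ => ?_⟩
  · filter_upwards [h1 τ hτ] with s hs
    refine (norm_neg _).symm.trans_le (le_of_eq_of_le ?_ hs)
    congr 1
    abel
  · filter_upwards [h2 τ hτ] with s hs
    refine (norm_neg _).symm.trans_le (le_of_eq_of_le ?_ hs)
    congr 1
    abel

theorem sub (h : IsKurzweilPrimitive U Φ) (h' : IsKurzweilPrimitive U' Φ') :
    IsKurzweilPrimitive (fun τ s => U τ s - U' τ s) (fun t => Φ t - Φ' t) := by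
  simpa only [sub_eq_add_neg] using h.add h'.neg

theorem clm_comp {𝕜 E' : Type*} [RCLike 𝕜] [NormedSpace 𝕜 E] [NormedAddCommGroup E']
    [NormedSpace 𝕜 E'] (h : IsKurzweilPrimitive U Φ) (L : E →L[𝕜] E') :
    IsKurzweilPrimitive (fun τ s => L (U τ s)) (fun t => L (Φ t)) := by
  intro a b hab ε hε
  obtain ⟨w, hw, h1, h2⟩ := h a b hab (ε / (‖L‖ + 1)) (by positivity)
  have key : ∀ (z : E) (r : ℝ), ‖z‖ ≤ r → ‖L z‖ ≤ (‖L‖ + 1) * r := fun z r hz =>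
    (L.le_opNorm z).trans (mul_le_mul (by linarith) hz (norm_nonneg _) (by positivity))
  refine ⟨fun t => (‖L‖ + 1) * w t, ?_, fun τ hτ => ?_, fun τ hτ => ?_⟩
  · rw [← mul_sub]
    calc _ ≤ (‖L‖ + 1) * (ε / (‖L‖ + 1)) := by gcongr
      _ = ε := by field_simp
  · filter_upwards [h1 τ hτ] with s hs
    simpa only [map_sub, mul_sub] using key _ _ hs
  · filter_upwards [h2 τ hτ] with s hs
    simpa only [map_sub, mul_sub] using key _ _ hs

theorem incrLE {v : ℝ → ℝ} (h : IsKurzweilPrimitive U Φ) (hU : ∀ τ, IncrLE (U τ) v) :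
    IncrLE Φ v := fun _ _ hst => (h.hasKurzweilIntegralOn hst).norm_le hst fun τ _ => hU τ

/-- The one-sided differentials of a primitive agree in the limit with those of `U`. -/
theorem tendsto_right (h : IsKurzweilPrimitive U Φ) (τ : ℝ) :
    Tendsto (fun t => Φ t - Φ τ - (U τ t - U τ τ)) (𝓝[>] τ) (𝓝 0) := by
  rw [Metric.tendsto_nhds]
  intro ε hε
  obtain ⟨w, hw, hw'⟩ := h τ (τ + 1) (by linarith) (ε / 2) (by linarith)
  filter_upwards [hw'.2 τ ⟨le_rfl, by linarith⟩, Ioo_mem_nhdsGT (show τ < τ + 1 by linarith)]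
    with t ht htI
  rw [dist_zero_right]
  -- Monotonicity of `w` is not part of the definition; comparing the integral with itself yields `w
  -- t ≤ w (τ + 1)`.
  have h3 : ‖Φ (τ + 1) - Φ t - (Φ (τ + 1) - Φ t)‖ ≤ w (τ + 1) - w t :=
    (h.hasKurzweilIntegralOn htI.2.le).norm_sub_le htI.2.le (hw'.mono htI.1.le le_rfl)
  linarith [norm_nonneg (Φ (τ + 1) - Φ t - (Φ (τ + 1) - Φ t))]

theorem tendsto_left (h : IsKurzweilPrimitive U Φ) (τ : ℝ) :
    Tendsto (fun s => Φ τ - Φ s - (U τ τ - U τ s)) (𝓝[<] τ) (𝓝 0) := by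
  rw [Metric.tendsto_nhds]
  intro ε hε
  obtain ⟨w, hw, hw'⟩ := h (τ - 1) τ (by linarith) (ε / 2) (by linarith)
  filter_upwards [hw'.1 τ ⟨by linarith, le_rfl⟩, Ioo_mem_nhdsLT (show τ - 1 < τ by linarith)]
    with t ht htI
  rw [dist_zero_right]
  have h3 : ‖Φ t - Φ (τ - 1) - (Φ t - Φ (τ - 1))‖ ≤ w t - w (τ - 1) :=
    (h.hasKurzweilIntegralOn htI.1.le).norm_sub_le htI.1.le (hw'.mono le_rfl htI.2.le)
  linarith [norm_nonneg (Φ t - Φ (τ - 1) - (Φ t - Φ (τ - 1)))]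

end IsKurzweilPrimitive

/-- A mean value inequality: one-sided local bounds on increments give a global bound, because the
zero integrand has integral zero. -/
theorem IsApproxPrimitive.norm_sub_le {m : ℝ → ℝ} (hab : a ≤ b)
    (h : IsApproxPrimitive (fun _ _ => 0) Φ m a b) : ‖Φ b - Φ a‖ ≤ m b - m a := by
  have h0 : HasKurzweilIntegralOn (fun _ _ => (0 : E)) a b 0 := fun ε hε =>
    ⟨fun _ => 1, fun _ _ => one_pos, fun D _ => by simpa [TaggedDivision.sum] using hε⟩
  simpa [norm_sub_rev] using h0.norm_sub_le hab h

end Primitive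

/-! ### Regulated functions and bounded variation -/

section Regulated

variable {E : Type*} [NormedAddCommGroup E]

/-- Both one-sided limits exist at every point, in the form of Cauchy conditions. -/
def IsRegulated (x : ℝ → E) : Prop :=
  ∀ τ, ∀ ε > 0, (∃ c, ∀ᶠ t in 𝓝[<] τ, ‖x t - c‖ ≤ ε) ∧ ∃ c, ∀ᶠ t in 𝓝[>] τ, ‖x t - c‖ ≤ ε

variable {f g : ℝ → E} {v u : ℝ → ℝ}

theorem IncrLE.monotone (h : IncrLE f v) : Monotone v := fun s t hst =>
  sub_nonneg.1 ((norm_nonneg _).trans (h s t hst))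

theorem IncrLE.norm_sub_le (h : IncrLE f v) (s t : ℝ) : ‖f t - f s‖ ≤ |v t - v s| := by
  rcases le_total s t with hst | hst
  · exact (h s t hst).trans (le_abs_self _)
  · rw [norm_sub_rev, abs_sub_comm]
    exact (h t s hst).trans (le_abs_self _)

theorem IncrLE.isRegulated (h : IncrLE f v) : IsRegulated f := by
  intro τ ε hε
  constructor
  · have h1 := Metric.tendsto_nhds.1 (h.monotone.tendsto_leftLim τ) (ε / 2) (by linarith)
    obtain ⟨t₁, ht₁⟩ := h1.exists
    refine ⟨f t₁, ?_⟩
    filter_upwards [h1] with t ht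
    rw [Real.dist_eq] at ht ht₁
    refine (h.norm_sub_le _ _).trans ?_
    rw [abs_lt] at ht ht₁
    rw [abs_le]
    constructor <;> linarith
  · have h1 := Metric.tendsto_nhds.1 (h.monotone.tendsto_rightLim τ) (ε / 2) (by linarith)
    obtain ⟨t₁, ht₁⟩ := h1.exists
    refine ⟨f t₁, ?_⟩
    filter_upwards [h1] with t ht
    rw [Real.dist_eq] at ht ht₁
    refine (h.norm_sub_le _ _).trans ?_
    rw [abs_lt] at ht ht₁
    rw [abs_le]
    constructor <;> linarith

theorem cauchy_map_of_forall_eventually {α : Type*} {l : Filter α} [l.NeBot] {f : α → E}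
    (h : ∀ ε > 0, ∃ c, ∀ᶠ t in l, ‖f t - c‖ ≤ ε) : Cauchy (map f l) := by
  rw [Metric.cauchy_iff]
  refine ⟨inferInstance, fun ε hε => ?_⟩
  obtain ⟨c, hc⟩ := h (ε / 3) (by linarith)
  refine ⟨_, image_mem_map hc, ?_⟩
  rintro _ ⟨r, hr, rfl⟩ _ ⟨s, hs, rfl⟩
  rw [dist_eq_norm]
  have hr : ‖f r - c‖ ≤ ε / 3 := hr
  have hs : ‖f s - c‖ ≤ ε / 3 := hs
  calc _ = ‖(f r - c) - (f s - c)‖ := by congr 1; abel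
    _ ≤ _ := _root_.norm_sub_le _ _
    _ < ε := by linarith

theorem IsRegulated.tendsto_leftLim [CompleteSpace E] (h : IsRegulated f) (τ : ℝ) :
    Tendsto f (𝓝[<] τ) (𝓝 (Function.leftLim f τ)) :=
  tendsto_leftLim_of_tendsto (cauchy_map_iff_exists_tendsto.1
    (cauchy_map_of_forall_eventually fun ε hε => (h τ ε hε).1))

theorem IsRegulated.tendsto_rightLim [CompleteSpace E] (h : IsRegulated f) (τ : ℝ) :
    Tendsto f (𝓝[>] τ) (𝓝 (Function.rightLim f τ)) :=
  tendsto_rightLim_of_tendsto (cauchy_map_iff_exists_tendsto.1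
    (cauchy_map_of_forall_eventually fun ε hε => (h τ ε hε).2))

/-- This closedness under uniform limits provides the complete space for the fixed-point argument.
-/
theorem isRegulated_of_approx (h : ∀ ε > 0, ∃ y, IsRegulated y ∧ ∀ t, ‖f t - y t‖ ≤ ε) :
    IsRegulated f := by
  intro τ ε hε
  obtain ⟨y, hy, hfy⟩ := h (ε / 2) (by linarith)
  obtain ⟨⟨c, hc⟩, ⟨d, hd⟩⟩ := hy τ (ε / 2) (by linarith)
  refine ⟨⟨c, hc.mono fun t ht => ?_⟩, ⟨d, hd.mono fun t ht => ?_⟩⟩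
  · calc _ = ‖(f t - y t) + (y t - c)‖ := by congr 1; abel
      _ ≤ _ := norm_add_le _ _
      _ ≤ ε := by linarith [hfy t]
  · calc _ = ‖(f t - y t) + (y t - d)‖ := by congr 1; abel
      _ ≤ _ := norm_add_le _ _
      _ ≤ ε := by linarith [hfy t]

theorem IncrLE.add (hf : IncrLE f v) (hg : IncrLE g u) :
    IncrLE (fun t => f t + g t) (fun t => v t + u t) := fun s t hst => by
  beta_reduce
  calc _ = ‖(f t - f s) + (g t - g s)‖ := by congr 1; abel
    _ ≤ _ := (norm_add_le _ _).trans (by linarith [hf s t hst, hg s t hst])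

theorem IncrLE.neg (hf : IncrLE f v) : IncrLE (fun t => -f t) v := fun s t hst => by
  rw [← neg_sub', norm_neg]
  exact hf s t hst

theorem IncrLE.sub (hf : IncrLE f v) (hg : IncrLE g u) :
    IncrLE (fun t => f t - g t) (fun t => v t + u t) := by
  simpa only [sub_eq_add_neg] using hf.add hg.neg

theorem IncrLE.exists_bound (hf : IncrLE f v) (a b : ℝ) :
    ∃ M, 0 ≤ M ∧ ∀ t ∈ Icc a b, ‖f t‖ ≤ M := by
  by_cases hab : a ≤ b
  · refine ⟨‖f a‖ + (v b - v a), ?_, fun t ht => ?_⟩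
    · linarith [norm_nonneg (f a), hf.monotone hab]
    · calc ‖f t‖ = ‖f a + (f t - f a)‖ := by congr 1; abel
        _ ≤ _ := (norm_add_le _ _).trans (by linarith [hf a t ht.1, hf.monotone ht.2])
  · exact ⟨0, le_rfl, fun t ht => absurd (ht.1.trans ht.2) hab⟩

theorem exists_incrLE_of_locallyBoundedVariationOn
    (h : LocallyBoundedVariationOn f univ) : ∃ v, IncrLE f v := by
  refine ⟨variationOnFromTo f univ 0, fun s t hst => ?_⟩
  have h1 := variationOnFromTo.add h (mem_univ 0) (mem_univ s) (mem_univ t)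
  have h2 := variationOnFromTo.eq_of_le f univ hst
  have h3 : ‖f t - f s‖ ≤ variationOnFromTo f univ s t := by
    rw [h2, ← dist_eq_norm, dist_edist]
    exact ENNReal.toReal_mono (h s t (mem_univ _) (mem_univ _))
      (eVariationOn.edist_le f ⟨mem_univ _, hst, le_rfl⟩ ⟨mem_univ _, le_rfl, hst⟩)
  linarith

/-- Controls on different intervals need not be compatible. Each bounds the variation on its
interval, and the variation function is a single control for the whole line. -/
theorem exists_incrLE_of_local (h : ∀ a b, a ≤ b → ∃ v : ℝ → ℝ, ∀ s ∈ Icc a b, ∀ t ∈ Icc a b,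
    s ≤ t → ‖f t - f s‖ ≤ v t - v s) : ∃ v, IncrLE f v := by
  refine exists_incrLE_of_locallyBoundedVariationOn fun a b _ _ => ?_
  rw [univ_inter]
  rcases le_or_gt a b with hab | hab
  · obtain ⟨v, hv⟩ := h a b hab
    have hmono : MonotoneOn v (Icc a b) := fun s hs t ht hst =>
      sub_nonneg.1 ((norm_nonneg _).trans (hv s hs t ht hst))
    have hle : eVariationOn f (Icc a b) ≤ eVariationOn v (Icc a b) := by
      refine iSup_le fun p => le_trans (Finset.sum_le_sum fun i _ => ?_)
        (eVariationOn.sum_le (f := v) p.2.2.1 p.2.2.2 (n := p.1))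
      have hm := p.2.2.1 (Nat.le_succ i)
      rw [edist_dist, edist_dist, dist_eq_norm, Real.dist_eq]
      exact ENNReal.ofReal_le_ofReal
        ((hv _ (p.2.2.2 i) _ (p.2.2.2 _) hm).trans (le_abs_self _))
    exact ne_top_of_le_ne_top ENNReal.ofReal_ne_top
      (hle.trans (le_of_eq (by
        simpa using hmono.eVariationOn_eq (left_mem_Icc.2 hab) (right_mem_Icc.2 hab))))
  · rw [Icc_eq_empty hab.not_ge]
    exact BoundedVariationOn.of_subsingleton subsingleton_empty

theorem locallyBoundedVariationOn_of_unitVariation_lt_top (h : unitVariation f < ⊤) :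
    LocallyBoundedVariationOn f univ := by
  intro a b _ _
  rw [univ_inter]
  rcases lt_or_ge a b with hab | hab
  · refine interval_induction (p := fun c d => BoundedVariationOn f (Icc c d)) ?_ ?_ hab
    · intro c d e hcd hde h1 h2
      have := eVariationOn.Icc_add_Icc f (s := univ) hcd.le hde.le (mem_univ d)
      simp only [univ_inter] at this
      rw [BoundedVariationOn, ← this]
      exact ENNReal.add_ne_top.2 ⟨h1, h2⟩
    · have key : ∀ c d, c < d → d ≤ c + 1 → BoundedVariationOn f (Icc c d) := fun c d h1 h2 =>
        (lt_of_le_of_lt (le_iSup_of_le c (le_iSup_of_le d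
          (le_iSup (fun _ : c < d ∧ d ≤ c + 1 => eVariationOn f (Icc c d)) ⟨h1, h2⟩))) h).ne
      refine fun t => ⟨?_, ?_⟩
      · filter_upwards [Ioo_mem_nhdsLT (show t - 1 < t by linarith)] with s hs
        exact key s t hs.2 (by linarith [hs.1])
      · filter_upwards [Ioo_mem_nhdsGT (show t < t + 1 by linarith)] with s hs
        exact key t s hs.1 (by linarith [hs.2])
  · exact BoundedVariationOn.of_subsingleton (subsingleton_Icc_of_ge hab)

end Regulated

/-! ### Existence of integrals for regulated integrands -/

section Existence

variable {E : Type*} [NormedAddCommGroup E] {E' : Type*} [NormedAddCommGroup E']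
  {U : ℝ → ℝ → E} {x : ℝ → E'} {v : ℝ → ℝ}

theorem IsApproxPrimitive.glue {Φ Φ' : ℝ → E} {w w' : ℝ → ℝ} {a b c : ℝ}
    (h : IsApproxPrimitive U Φ w a b) (h' : IsApproxPrimitive U Φ' w' b c) :
    IsApproxPrimitive U (fun t => if t ≤ b then Φ t else Φ' t - Φ' b + Φ b)
      (fun t => if t ≤ b then w t else w' t - w' b + w b) a c := by
  refine ⟨fun τ hτ => ?_, fun τ hτ => ?_⟩
  · rcases le_or_gt τ b with hb | hb
    · filter_upwards [h.1 τ ⟨hτ.1, hb⟩, self_mem_nhdsWithin] with s hs hlt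
      simpa only [hb, if_true, (le_of_lt hlt : s ≤ τ).trans hb] using hs
    · filter_upwards [h'.1 τ ⟨hb, hτ.2⟩, Ioo_mem_nhdsLT hb] with s hs hlt
      simpa only [hb.not_ge, hlt.1.not_ge, if_false, add_sub_add_right_eq_sub,
        sub_sub_sub_cancel_right] using hs
  · rcases lt_or_ge τ b with hb | hb
    · filter_upwards [h.2 τ ⟨hτ.1, hb⟩, Ioo_mem_nhdsGT hb] with s hs hlt
      simpa only [hb.le, if_true, hlt.2.le] using hs
    · filter_upwards [h'.2 τ ⟨hb, hτ.2⟩, self_mem_nhdsWithin] with s hs hlt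
      have hs' : ¬ s ≤ b := not_le.2 (hb.trans_lt hlt)
      rcases hb.eq_or_lt with rfl | hb
      · simpa only [le_refl, if_true, hs', if_false, add_sub_cancel_right] using hs
      · simpa only [hb.not_ge, hs', if_false, add_sub_add_right_eq_sub,
          sub_sub_sub_cancel_right] using hs

/-- On a short open interval beside a point, `x` is nearly constant, so `U` with its tag frozen is
an approximate primitive. Such pieces are glued by interval induction. -/
theorem exists_primitive_of_isRegulated [CompleteSpace E] (hv : Monotone v) (hx : IsRegulated x)
    (hU : ∀ τ τ' s t, s ≤ t →
      ‖U τ t - U τ s - (U τ' t - U τ' s)‖ ≤ ‖x τ - x τ'‖ * (v t - v s)) :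
    ∃ Φ, Φ 0 = 0 ∧ IsKurzweilPrimitive U Φ := by
  refine exists_isKurzweilPrimitive fun a b hab ε hε => ?_
  -- Adding the identity to `v` makes the error budget positive even where `v` is constant; the
  -- share given by the length pays for the correction at the endpoint.
  have hω : 0 < (v b + b) - (v a + a) := by linarith [hv hab.le]
  obtain ⟨κ, hκ, hκε⟩ : ∃ κ > 0, κ * ((v b + b) - (v a + a)) = ε :=
    ⟨ε / ((v b + b) - (v a + a)), by positivity, by field_simp⟩
  rw [← hκε]
  have hD : ∀ τ τ', IncrLE (fun t => U τ t - U τ' t) (fun t => ‖x τ - x τ'‖ * v t) := by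
    intro τ τ' s t hst
    beta_reduce
    rw [← mul_sub]
    refine le_of_eq_of_le ?_ (hU τ τ' s t hst)
    congr 1; abel
  have hU' : ∀ {τ τ' c s t}, ‖x τ - c‖ ≤ κ / 2 → ‖x τ' - c‖ ≤ κ / 2 → s ≤ t →
      ‖U τ t - U τ s - (U τ' t - U τ' s)‖ ≤ κ * v t - κ * v s := by
    intro τ τ' c s t h1 h2 hst
    refine (hU τ τ' s t hst).trans ?_
    rw [← mul_sub]
    refine mul_le_mul_of_nonneg_right ?_ (sub_nonneg.2 (hv hst))
    calc ‖x τ - x τ'‖ = ‖(x τ - c) - (x τ' - c)‖ := by congr 1; abel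
      _ ≤ _ := (norm_sub_le _ _).trans (by linarith)
  refine interval_induction (p := fun c d => ∃ (Φ : ℝ → E) (w : ℝ → ℝ),
    w d - w c ≤ κ * ((v d + d) - (v c + c)) ∧ IsApproxPrimitive U Φ w c d) ?_ ?_ hab
  · rintro c d e hcd hde ⟨Φ, w, hw, hΦ⟩ ⟨Φ', w', hw', hΦ'⟩
    refine ⟨_, _, ?_, hΦ.glue hΦ'⟩
    simp only [hcd.le, if_true, hde.not_ge, if_false]
    linarith
  · intro τ₀
    obtain ⟨⟨c, hc⟩, ⟨c', hc'⟩⟩ := hx τ₀ (κ / 2) (by linarith)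
    constructor
    · obtain ⟨l, hl, hl'⟩ := mem_nhdsLT_iff_exists_Ioo_subset.1 hc
      filter_upwards [Ioo_mem_nhdsLT hl] with e he
      -- The frozen tag `e` is wrong at `τ₀`, where `x` may jump. There `k` approximates the left
      -- limit of `U e - U τ₀`, and the value of the primitive at `τ₀` is corrected by it.
      obtain ⟨⟨k, hk⟩, -⟩ := (hD e τ₀).isRegulated τ₀ (κ * (τ₀ - e)) (mul_pos hκ (sub_pos.2 he.2))
      refine ⟨fun t => if τ₀ ≤ t then k + U τ₀ τ₀ else U e t,
        fun t => κ * v t + if τ₀ ≤ t then κ * (τ₀ - e) else 0, ?_, fun τ hτ => ?_,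
        fun τ hτ => ?_⟩
      · simp only [le_refl, if_true, he.2.not_ge, if_false]
        linarith
      · rcases hτ.2.eq_or_lt with rfl | hlt
        · filter_upwards [hk, self_mem_nhdsWithin] with s hs hlt
          have hlt : s < τ := hlt
          simp only [le_refl, if_true, hlt.not_ge, if_false]
          have h1 : κ * v s ≤ κ * v τ := mul_le_mul_of_nonneg_left (hv hlt.le) hκ.le
          calc _ = ‖U e s - U τ s - k‖ := by rw [← norm_neg]; congr 1; abel
            _ ≤ _ := hs.trans (by linarith)
        · filter_upwards [Ioo_mem_nhdsLT hτ.1] with s hs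
          simp only [hlt.not_ge, (hs.2.trans hlt).not_ge, if_false, add_zero]
          exact hU' (hl' he) (hl' ⟨he.1.trans hτ.1, hlt⟩) hs.2.le
      · filter_upwards [Ioo_mem_nhdsGT hτ.2] with s hs
        simp only [hτ.2.not_ge, hs.2.not_ge, if_false, add_zero]
        exact hU' (hl' he) (hl' ⟨he.1.trans_le hτ.1, hτ.2⟩) hs.1.le
    · obtain ⟨r, hr, hr'⟩ := mem_nhdsGT_iff_exists_Ioo_subset.1 hc'
      filter_upwards [Ioo_mem_nhdsGT hr] with d hd
      obtain ⟨-, ⟨k, hk⟩⟩ := (hD d τ₀).isRegulated τ₀ (κ * (d - τ₀)) (mul_pos hκ (sub_pos.2 hd.1))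
      refine ⟨fun t => if t ≤ τ₀ then k + U τ₀ τ₀ else U d t,
        fun t => κ * v t + if t ≤ τ₀ then 0 else κ * (d - τ₀), ?_, fun τ hτ => ?_,
        fun τ hτ => ?_⟩
      · simp only [le_refl, if_true, hd.1.not_ge, if_false]
        linarith
      · filter_upwards [Ioo_mem_nhdsLT hτ.1] with s hs
        simp only [hτ.1.not_ge, hs.1.not_ge, if_false, add_sub_add_right_eq_sub]
        exact hU' (hr' hd) (hr' ⟨hτ.1, hτ.2.trans_lt hd.2⟩) hs.2.le
      · rcases hτ.1.eq_or_lt with rfl | hlt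
        · filter_upwards [hk, self_mem_nhdsWithin] with s hs hlt
          have hlt : τ₀ < s := hlt
          simp only [le_refl, if_true, hlt.not_ge, if_false]
          have h1 : κ * v τ₀ ≤ κ * v s := mul_le_mul_of_nonneg_left (hv hlt.le) hκ.le
          calc _ = ‖U d s - U τ₀ s - k‖ := by congr 1; abel
            _ ≤ _ := hs.trans (by linarith)
        · filter_upwards [Ioo_mem_nhdsGT hτ.2] with s hs
          simp only [hlt.not_ge, (hlt.trans hs.1).not_ge, if_false, add_sub_add_right_eq_sub]
          exact hU' (hr' hd) (hr' ⟨hlt, hτ.2.trans hd.2⟩) hs.1.le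

end Existence

/-! ### Homogeneous linear equations and variation of constants -/

section Linear

variable {𝕜 : Type*} [RCLike 𝕜] {X : Type*} [NormedAddCommGroup X] [NormedSpace 𝕜 X]
  {A W : ℝ → X →L[𝕜] X} {a v : ℝ → ℝ}

theorem IncrLE.clm_apply (hW : IncrLE W v) {x : X} {S : ℝ} (hx : ‖x‖ ≤ S) :
    IncrLE (fun s => W s x) (fun s => S * v s) := fun s t hst => by
  beta_reduce
  rw [← _root_.sub_apply, ← mul_sub, mul_comm S]
  exact ((W t - W s).le_opNorm x).trans
    (mul_le_mul (hW s t hst) hx (norm_nonneg _) (sub_nonneg.2 (hW.monotone hst)))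

theorem exists_primitive_stieltjes [CompleteSpace X] {g : ℝ → X} (hW : IncrLE W v)
    (hg : IsRegulated g) :
    ∃ Q, Q 0 = 0 ∧ IsKurzweilPrimitive (fun τ s => W s (g τ)) Q := by
  refine exists_primitive_of_isRegulated hW.monotone hg fun τ τ' s t hst => ?_
  calc _ = ‖(W t - W s) (g τ - g τ')‖ := by
        congr 1; simp only [map_sub, _root_.sub_apply]
    _ ≤ ‖W t - W s‖ * ‖g τ - g τ'‖ := (W t - W s).le_opNorm _
    _ ≤ _ := by
      rw [mul_comm]
      exact mul_le_mul_of_nonneg_left (hW s t hst) (norm_nonneg _)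

theorem exists_primitive_comp [CompleteSpace X] {B : ℝ → X →L[𝕜] X} (hW : IncrLE W v)
    (hB : IsRegulated B) :
    ∃ Q, Q 0 = 0 ∧ IsKurzweilPrimitive (fun τ s => (W s).comp (B τ)) Q := by
  refine exists_primitive_of_isRegulated hW.monotone hB fun τ τ' s t hst => ?_
  calc _ = ‖(W t - W s).comp (B τ - B τ')‖ := by
        congr 1; simp only [ContinuousLinearMap.comp_sub, ContinuousLinearMap.sub_comp]
    _ ≤ ‖W t - W s‖ * ‖B τ - B τ'‖ := ContinuousLinearMap.opNorm_comp_le _ _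
    _ ≤ _ := by
      rw [mul_comm]
      exact mul_le_mul_of_nonneg_left (hW s t hst) (norm_nonneg _)

/-- Solutions of locally bounded variation of the homogeneous equation `dx/dτ = D[A(t)x]`. -/
def IsHomogeneousSolution (A : ℝ → X →L[𝕜] X) (u : ℝ → X) : Prop :=
  (∃ v, IncrLE u v) ∧ IsKurzweilPrimitive (fun τ s => A s (u τ)) u

theorem IsHomogeneousSolution.sub {u u' : ℝ → X} (h : IsHomogeneousSolution A u)
    (h' : IsHomogeneousSolution A u') : IsHomogeneousSolution A (fun t => u t - u' t) := by
  obtain ⟨⟨v, hv⟩, h⟩ := h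
  obtain ⟨⟨v', hv'⟩, h'⟩ := h'
  exact ⟨⟨_, hv.sub hv'⟩, by simpa only [map_sub] using h.sub h'⟩

theorem IsHomogeneousSolution.tendsto_right [CompleteSpace X] {u : ℝ → X}
    (h : IsHomogeneousSolution A u) (hA : IncrLE A a) (τ : ℝ) :
    Tendsto u (𝓝[>] τ) (𝓝 ((1 + (Function.rightLim A τ - A τ)) (u τ))) := by
  have h1 := h.2.tendsto_right τ
  have h2 : Tendsto (fun t => A t (u τ)) (𝓝[>] τ) (𝓝 (Function.rightLim A τ (u τ))) :=
    ((ContinuousLinearMap.apply 𝕜 X (u τ)).continuous.tendsto _).comp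
      (hA.isRegulated.tendsto_rightLim τ)
  have h3 := (h1.add (h2.sub_const (A τ (u τ)))).add_const (u τ)
  refine (h3.congr fun t => ?_).trans_eq ?_
  · abel
  · simp [add_comm]

theorem IsHomogeneousSolution.tendsto_left [CompleteSpace X] {u : ℝ → X}
    (h : IsHomogeneousSolution A u) (hA : IncrLE A a) (τ : ℝ) :
    Tendsto u (𝓝[<] τ) (𝓝 ((1 - (A τ - Function.leftLim A τ)) (u τ))) := by
  have h1 := h.2.tendsto_left τ
  have h2 : Tendsto (fun t => A t (u τ)) (𝓝[<] τ) (𝓝 (Function.leftLim A τ (u τ))) :=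
    ((ContinuousLinearMap.apply 𝕜 X (u τ)).continuous.tendsto _).comp
      (hA.isRegulated.tendsto_leftLim τ)
  have h3 := ((h1.add (h2.const_sub (A τ (u τ)))).const_sub (u τ))
  refine (h3.congr fun t => ?_).trans_eq ?_
  · abel
  · simp

theorem IsHomogeneousSolution.norm_sub_le {u : ℝ → X} (h : IsHomogeneousSolution A u)
    (hA : IncrLE A a) {s t S : ℝ} (hS : ∀ r ∈ uIcc s t, ‖u r‖ ≤ S) (ha : |a t - a s| ≤ 1 / 2) :
    ‖u t - u s‖ ≤ S / 2 := by
  have hS0 : 0 ≤ S := (norm_nonneg _).trans (hS s left_mem_uIcc)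
  have key : ∀ s t, s ≤ t → (∀ r ∈ Icc s t, ‖u r‖ ≤ S) → |a t - a s| ≤ 1 / 2 →
      ‖u t - u s‖ ≤ S / 2 := by
    intro s t hst hS ha
    have h1 := (h.2.hasKurzweilIntegralOn hst).norm_le hst fun τ hτ => hA.clm_apply (hS τ hτ)
    rw [← mul_sub] at h1
    exact h1.trans ((mul_le_mul_of_nonneg_left ((le_abs_self _).trans ha) hS0).trans_eq (by ring))
  rcases le_total s t with hst | hst
  · rw [uIcc_of_le hst] at hS
    exact key s t hst hS ha
  · rw [uIcc_of_ge hst] at hS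
    rw [norm_sub_rev]
    exact key t s hst hS (by rwa [abs_sub_comm])

/-- If `S` is the supremum of `‖u‖` on `I`, then `S ≤ ‖u s‖ + S / 2`, so norms on `I` are comparable
with factor 2. The limit `T (u τ)` and the inverse of `T` extend this to `τ`; the constant covers
all four positions of `s` and `t`. -/
theorem norm_le_mul_of_oscillation_le {I : Set ℝ} {l : Filter ℝ} [l.NeBot] (hI : I ∈ l)
    {u : ℝ → X} {τ : ℝ} {T : X →L[𝕜] X} (hT : IsUnit T) (hbdd : ∃ M, ∀ t ∈ I, ‖u t‖ ≤ M)
    (hosc : ∀ S, (∀ t ∈ I, ‖u t‖ ≤ S) → ∀ s ∈ I, ∀ t ∈ I, ‖u t - u s‖ ≤ S / 2)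
    (hlim : Tendsto u l (𝓝 (T (u τ)))) :
    ∀ s ∈ insert τ I, ∀ t ∈ insert τ I,
      ‖u t‖ ≤ (3 + 2 * ‖T‖ + 2 * ‖Ring.inverse T‖) * ‖u s‖ := by
  have h1 : ∀ s ∈ I, ∀ t ∈ I, ‖u t‖ ≤ 2 * ‖u s‖ := by
    intro s hs t ht
    have hb : BddAbove ((fun t => ‖u t‖) '' I) := by
      obtain ⟨M, hM⟩ := hbdd
      exact ⟨M, by rintro _ ⟨t, ht, rfl⟩; exact hM t ht⟩
    set S := sSup ((fun t => ‖u t‖) '' I)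
    have hS : ∀ t ∈ I, ‖u t‖ ≤ S := fun t ht => le_csSup hb ⟨t, ht, rfl⟩
    have hS' : S ≤ ‖u s‖ + S / 2 := by
      refine csSup_le ⟨_, s, hs, rfl⟩ ?_
      rintro _ ⟨r, hr, rfl⟩
      calc ‖u r‖ = ‖u s + (u r - u s)‖ := by congr 1; abel
        _ ≤ _ := (norm_add_le _ _).trans (by linarith [hosc S hS s hs r hr])
    linarith [hS t ht]
  have h2 : ∀ t ∈ I, ‖u t‖ ≤ 2 * ‖T (u τ)‖ := fun t ht =>
    ge_of_tendsto (hlim.norm.const_mul 2) (mem_of_superset hI fun s hs => h1 s hs t ht)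
  have h3 : ∀ s ∈ I, ‖T (u τ)‖ ≤ 2 * ‖u s‖ := fun s hs =>
    le_of_tendsto hlim.norm (mem_of_superset hI fun t ht => h1 s hs t ht)
  have h4 : ‖u τ‖ ≤ ‖Ring.inverse T‖ * ‖T (u τ)‖ := by
    have : u τ = Ring.inverse T (T (u τ)) := by
      rw [← mul_apply_eq_comp, Ring.inverse_mul_cancel T hT,
        one_apply_eq_self]
    exact (congrArg norm this).trans_le ((Ring.inverse T).le_opNorm (T (u τ)))
  have hT0 := norm_nonneg T
  have hT1 := norm_nonneg (Ring.inverse T)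
  intro s hs t ht
  have hs0 := norm_nonneg (u s)
  have p1 := mul_nonneg hT0 hs0
  have p2 := mul_nonneg hT1 hs0
  rcases hs with rfl | hs <;> rcases ht with rfl | ht
  · nlinarith
  · have := h2 t ht
    have := T.le_opNorm (u s)
    nlinarith
  · have := mul_le_mul_of_nonneg_left (h3 s hs) hT1
    nlinarith
  · have := h1 s hs t ht
    nlinarith

/-- The constant is the same for all solutions and for both directions of time. Hence a solution
vanishing at one point vanishes everywhere, and 𝒱⁻¹ is bounded on compact intervals. -/
theorem exists_norm_le_mul [CompleteSpace X] (hA : IncrLE A a)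
    (hl : ∀ t, IsUnit (1 - (A t - Function.leftLim A t)))
    (hr : ∀ t, IsUnit (1 + (Function.rightLim A t - A t))) {c d : ℝ} (hcd : c < d) :
    ∃ L, 0 ≤ L ∧ ∀ u, IsHomogeneousSolution A u → ∀ s ∈ Icc c d, ∀ t ∈ Icc c d,
      ‖u t‖ ≤ L * ‖u s‖ := by
  refine interval_induction (p := fun c d => ∃ L, 0 ≤ L ∧ ∀ u, IsHomogeneousSolution A u →
    ∀ s ∈ Icc c d, ∀ t ∈ Icc c d, ‖u t‖ ≤ L * ‖u s‖) ?_ ?_ hcd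
  · rintro c d e hcd hde ⟨L, hL, h⟩ ⟨L', hL', h'⟩
    refine ⟨L + L' + L * L' + L' * L, by positivity, fun u hu s hs t ht => ?_⟩
    have hs0 := norm_nonneg (u s)
    have p1 := mul_nonneg hL hs0
    have p2 := mul_nonneg hL' hs0
    have p3 := mul_nonneg (mul_nonneg hL hL') hs0
    have hd := right_mem_Icc.2 hcd.le
    have hd' := left_mem_Icc.2 hde.le
    rcases le_total s d with hsd | hsd <;> rcases le_total t d with htd | htd
    · have := h u hu s ⟨hs.1, hsd⟩ t ⟨ht.1, htd⟩
      nlinarith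
    · have h1 := h' u hu d hd' t ⟨htd, ht.2⟩
      have h2 := mul_le_mul_of_nonneg_left (h u hu s ⟨hs.1, hsd⟩ d hd) hL'
      nlinarith
    · have h1 := h u hu d hd t ⟨ht.1, htd⟩
      have h2 := mul_le_mul_of_nonneg_left (h' u hu s ⟨hsd, hs.2⟩ d hd') hL
      nlinarith
    · have := h' u hu s ⟨hsd, hs.2⟩ t ⟨htd, ht.2⟩
      nlinarith
  · intro τ
    constructor
    · obtain ⟨l, hlτ, hl'⟩ := mem_nhdsLT_iff_exists_Ioo_subset.1
        -- Two values of `a` within 1/4 of its one-sided limit differ by at most 1/2, as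
        -- `IsHomogeneousSolution.norm_sub_le` requires.
        (Metric.tendsto_nhds.1 (hA.monotone.tendsto_leftLim τ) (1 / 4) (by norm_num))
      filter_upwards [Ioo_mem_nhdsLT hlτ] with e he
      refine ⟨_, ?_, fun u hu s hs t ht => norm_le_mul_of_oscillation_le (I := Ico e τ) (τ := τ)
        (Ico_mem_nhdsLT he.2) (hl τ) ?_ ?_ (hu.tendsto_left hA τ) s ?_ t ?_⟩
      · positivity
      · obtain ⟨v, hv⟩ := hu.1
        obtain ⟨M, -, hM⟩ := hv.exists_bound e τ
        exact ⟨M, fun t ht => hM t ⟨ht.1, ht.2.le⟩⟩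
      · intro S hS s hs t ht
        refine hu.norm_sub_le hA (fun r hr => hS r ?_) ?_
        · exact ⟨(le_min hs.1 ht.1).trans hr.1, hr.2.trans_lt (max_lt hs.2 ht.2)⟩
        · have h1 := hl' ⟨he.1.trans_le hs.1, hs.2⟩
          have h2 := hl' ⟨he.1.trans_le ht.1, ht.2⟩
          rw [mem_ofPred_eq, Real.dist_eq, abs_lt] at h1 h2
          rw [abs_le]
          constructor <;> linarith
      · rw [Ico_insert_right he.2.le]; exact hs
      · rw [Ico_insert_right he.2.le]; exact ht
    · obtain ⟨r, hrτ, hr'⟩ := mem_nhdsGT_iff_exists_Ioo_subset.1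
        (Metric.tendsto_nhds.1 (hA.monotone.tendsto_rightLim τ) (1 / 4) (by norm_num))
      filter_upwards [Ioo_mem_nhdsGT hrτ] with e he
      refine ⟨_, ?_, fun u hu s hs t ht => norm_le_mul_of_oscillation_le (I := Ioc τ e) (τ := τ)
        (Ioc_mem_nhdsGT he.1) (hr τ) ?_ ?_ (hu.tendsto_right hA τ) s ?_ t ?_⟩
      · positivity
      · obtain ⟨v, hv⟩ := hu.1
        obtain ⟨M, -, hM⟩ := hv.exists_bound τ e
        exact ⟨M, fun t ht => hM t ⟨ht.1.le, ht.2⟩⟩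
      · intro S hS s hs t ht
        refine hu.norm_sub_le hA (fun r hr => hS r ?_) ?_
        · exact ⟨(lt_min hs.1 ht.1).trans_le hr.1, hr.2.trans (max_le hs.2 ht.2)⟩
        · have h1 := hr' ⟨hs.1, hs.2.trans_lt he.2⟩
          have h2 := hr' ⟨ht.1, ht.2.trans_lt he.2⟩
          rw [mem_ofPred_eq, Real.dist_eq, abs_lt] at h1 h2
          rw [abs_le]
          constructor <;> linarith
      · rw [Ioc_insert_left he.1.le]; exact hs
      · rw [Ioc_insert_left he.1.le]; exact ht

theorem IsHomogeneousSolution.eq_zero [CompleteSpace X] (hA : IncrLE A a)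
    (hl : ∀ t, IsUnit (1 - (A t - Function.leftLim A t)))
    (hr : ∀ t, IsUnit (1 + (Function.rightLim A t - A t))) {u : ℝ → X}
    (hu : IsHomogeneousSolution A u) {s : ℝ} (hs : u s = 0) (t : ℝ) : u t = 0 := by
  obtain ⟨L, -, h⟩ := exists_norm_le_mul hA hl hr (c := min s t) (d := max s t + 1)
    (lt_of_le_of_lt min_le_max (lt_add_one _))
  have := h u hu s ⟨min_le_left _ _, by linarith [le_max_left s t]⟩ t
    ⟨min_le_right _ _, by linarith [le_max_right s t]⟩
  simpa [hs] using this

/-- Variation of constants. -/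
theorem IsKurzweilPrimitive.variation_of_constants {Y Z : ℝ → X →L[𝕜] X} {g Q : ℝ → X}
    {vY vZ vg vQ : ℝ → ℝ} (hY : IncrLE Y vY) (hZ : IncrLE Z vZ) (hg : IncrLE g vg)
    (hQ : IncrLE Q vQ) (hYZ : ∀ t ξ, Y t (Z t ξ) = ξ)
    (hYp : IsKurzweilPrimitive (fun τ s => (A s).comp (Y τ)) Y)
    (hQp : IsKurzweilPrimitive (fun τ s => Z s (g τ)) Q) (c : X) :
    IsKurzweilPrimitive (fun τ s => A s (g τ + Y τ (c - Q τ))) (fun t => Y t (c - Q t)) := by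
  intro p q hpq ε hε
  obtain ⟨MY, hMY, bY⟩ := hY.exists_bound p q
  obtain ⟨MZ, hMZ, bZ⟩ := hZ.exists_bound p q
  obtain ⟨Mg, hMg, bg⟩ := hg.exists_bound p q
  obtain ⟨MQ, hMQ, bQ⟩ := hQ.exists_bound p q
  set N := ‖c‖ + MQ + MZ * Mg + MY + 1 with hN
  have hN0 : 0 < N := by positivity
  obtain ⟨w, hw, h1, h2⟩ := hYp p q hpq (ε / (2 * N)) (by positivity)
  obtain ⟨w', hw', h1', h2'⟩ := hQp p q hpq (ε / (2 * N)) (by positivity)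
  -- With `e`, `e'` the defects of `Y` and `Q` at the tag, the product rule and `Y Z = I` make the
  -- defect of `Y (c - Q)` exactly `e (c - Q τ + Z τ (g τ)) - Y s e'`.
  have bound : ∀ τ ∈ Icc p q, ∀ s ∈ Icc p q, ∀ (e : X →L[𝕜] X) (e' : X) (r r' : ℝ), ‖e‖ ≤ r →
      ‖e'‖ ≤ r' → ‖e (c - Q τ + Z τ (g τ)) - Y s e'‖ ≤ N * (r + r') := by
    intro τ hτ s hs e e' r r' hr hr'
    have k1 : ‖c - Q τ + Z τ (g τ)‖ ≤ N := by
      have z1 : ‖Z τ (g τ)‖ ≤ MZ * Mg := ((Z τ).le_opNorm _).trans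
        (mul_le_mul (bZ τ hτ) (bg τ hτ) (norm_nonneg _) hMZ)
      have z2 := norm_sub_le c (Q τ)
      have z3 := norm_add_le (c - Q τ) (Z τ (g τ))
      have := bQ τ hτ
      linarith
    have k2 : ‖Y s‖ ≤ N := by
      have := bY s hs
      have : 0 ≤ ‖c‖ + MQ + MZ * Mg := by positivity
      linarith
    have k3 := (e.le_opNorm (c - Q τ + Z τ (g τ))).trans
      (mul_le_mul hr k1 (norm_nonneg _) ((norm_nonneg _).trans hr))
    have k4 := ((Y s).le_opNorm e').trans (mul_le_mul k2 hr' (norm_nonneg _) hN0.le)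
    exact (norm_sub_le _ _).trans (by linarith)
  refine ⟨fun t => N * (w t + w' t), ?_, fun τ hτ => ?_, fun τ hτ => ?_⟩
  · have : N * ((w q - w p) + (w' q - w' p)) ≤ N * (ε / (2 * N) + ε / (2 * N)) := by gcongr
    have e : N * (ε / (2 * N) + ε / (2 * N)) = ε := by field_simp; ring
    linarith
  · filter_upwards [h1 τ hτ, h1' τ hτ, Ioo_mem_nhdsLT hτ.1] with s hs hs' hI
    have := bound τ ⟨hτ.1.le, hτ.2⟩ s ⟨hI.1.le, hI.2.le.trans hτ.2⟩ _ _ _ _ hs hs'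
    refine le_of_eq_of_le (congrArg norm ?_) (this.trans_eq (by ring))
    simp only [map_sub, map_add, _root_.sub_apply, ContinuousLinearMap.comp_apply,
      hYZ]
    abel
  · filter_upwards [h2 τ hτ, h2' τ hτ, Ioo_mem_nhdsGT hτ.2] with s hs hs' hI
    have := bound τ ⟨hτ.1, hτ.2.le⟩ s ⟨hτ.1.trans hI.1.le, hI.2.le⟩ _ _ _ _ hs hs'
    refine le_of_eq_of_le (congrArg norm ?_) (this.trans_eq (by ring))
    simp only [map_sub, map_add, _root_.sub_apply, ContinuousLinearMap.comp_apply,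
      hYZ]
    abel

end Linear

/-! ### The fundamental operator and its inverse -/

section Fundamental

variable {𝕜 : Type*} [RCLike 𝕜] {X : Type*} [NormedAddCommGroup X] [NormedSpace 𝕜 X]
  [CompleteSpace X] {A : ℝ → X →L[𝕜] X} {V : ℝ → ℝ → X →L[𝕜] X} {a : ℝ → ℝ}

namespace IsFundamentalOperator

/-- The defining equation only has integrals starting at `s`. Bounded variation of `V(·, s)` gives a
primitive, which has the same increments. -/
theorem isKurzweilPrimitive (hV : IsFundamentalOperator A V) (hA : IncrLE A a) (s : ℝ) :
    IsKurzweilPrimitive (fun τ r => (A r).comp (V τ s)) (fun t => V t s) := by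
  obtain ⟨v, hv⟩ := exists_incrLE_of_locallyBoundedVariationOn (hV.locallyBV s)
  obtain ⟨Φ, -, hΦ⟩ := exists_primitive_comp hA hv.isRegulated
  refine hΦ.of_sub_eq fun r t _ => ?_
  have h1 := (hΦ.hasKurzweilIntegral s t).unique (hV.integral_eq t s)
  have h2 := (hΦ.hasKurzweilIntegral s r).unique (hV.integral_eq r s)
  rw [← sub_sub_sub_cancel_right (V t s) (V r s) (ContinuousLinearMap.id 𝕜 X), ← h1, ← h2]
  abel

theorem self_eq (hV : IsFundamentalOperator A V) (hA : IncrLE A a) (s : ℝ) : V s s = 1 := by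
  have h := ((hV.isKurzweilPrimitive hA s).hasKurzweilIntegral s s).unique (hV.integral_eq s s)
  rw [sub_self] at h
  exact sub_eq_zero.1 h.symm

theorem isHomogeneousSolution (hV : IsFundamentalOperator A V) (hA : IncrLE A a) (s : ℝ) (ξ : X) :
    IsHomogeneousSolution A (fun t => V t s ξ) := by
  obtain ⟨v, hv⟩ := exists_incrLE_of_locallyBoundedVariationOn (hV.locallyBV s)
  exact ⟨⟨_, hv.clm_apply le_rfl⟩,
    (hV.isKurzweilPrimitive hA s).clm_comp (ContinuousLinearMap.apply 𝕜 X ξ)⟩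

theorem eq_apply_of_isHomogeneousSolution (hV : IsFundamentalOperator A V) (hA : IncrLE A a)
    (hl : ∀ t, IsUnit (1 - (A t - Function.leftLim A t)))
    (hr : ∀ t, IsUnit (1 + (Function.rightLim A t - A t))) {u : ℝ → X}
    (hu : IsHomogeneousSolution A u) (t s : ℝ) : u t = V t s (u s) :=
  sub_eq_zero.1 ((hu.sub (hV.isHomogeneousSolution hA s (u s))).eq_zero hA hl hr (s := s)
    (by simp [hV.self_eq hA]) t)

theorem apply_apply (hV : IsFundamentalOperator A V) (hA : IncrLE A a)
    (hl : ∀ t, IsUnit (1 - (A t - Function.leftLim A t)))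
    (hr : ∀ t, IsUnit (1 + (Function.rightLim A t - A t))) (s t : ℝ) (ξ : X) :
    V s t (V t s ξ) = ξ := by
  have := hV.eq_apply_of_isHomogeneousSolution hA hl hr (hV.isHomogeneousSolution hA s ξ) s t
  simpa [hV.self_eq hA] using this.symm

/-- The increments of an inverse satisfy V(0,t) - V(0,s) = V(0,t)(V(s,0) - V(t,0))V(0,s), and the
comparison estimate bounds both outer factors locally. -/
theorem exists_incrLE_inverse (hV : IsFundamentalOperator A V) (hA : IncrLE A a)
    (hl : ∀ t, IsUnit (1 - (A t - Function.leftLim A t)))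
    (hr : ∀ t, IsUnit (1 + (Function.rightLim A t - A t))) :
    ∃ v, IncrLE (fun t => V 0 t) v := by
  refine exists_incrLE_of_local fun c d hcd => ?_
  obtain ⟨v, hv⟩ := exists_incrLE_of_locallyBoundedVariationOn (hV.locallyBV 0)
  obtain ⟨L, hL, h⟩ := exists_norm_le_mul hA hl hr (c := min c 0) (d := max d 0 + 1)
    (by linarith [min_le_right c 0, le_max_right d 0])
  have hbd : ∀ t ∈ Icc c d, ‖V 0 t‖ ≤ L := by
    refine fun t ht => ContinuousLinearMap.opNorm_le_bound _ hL fun ξ => ?_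
    have := h _ (hV.isHomogeneousSolution hA t ξ) t
      ⟨(min_le_left _ _).trans ht.1, by linarith [ht.2, le_max_left d 0]⟩ 0
      ⟨min_le_right _ _, by linarith [le_max_right d 0]⟩
    simpa [hV.self_eq hA] using this
  refine ⟨fun t => L * L * v t, fun s hs t ht hst => ?_⟩
  have e : V 0 t - V 0 s = (V 0 t).comp ((V s 0 - V t 0).comp (V 0 s)) := by
    ext ξ
    simp [hV.apply_apply hA hl hr]
  rw [e, ← mul_sub]
  have hv' : ‖V s 0 - V t 0‖ ≤ v t - v s := by
    rw [norm_sub_rev]; exact hv s t hst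
  calc _ ≤ ‖V 0 t‖ * ‖(V s 0 - V t 0).comp (V 0 s)‖ := ContinuousLinearMap.opNorm_comp_le _ _
    _ ≤ ‖V 0 t‖ * (‖V s 0 - V t 0‖ * ‖V 0 s‖) := by
      gcongr; exact ContinuousLinearMap.opNorm_comp_le _ _
    _ ≤ L * ((v t - v s) * L) := by
      have := hv.monotone hst
      gcongr
      · exact hbd t ht
      · exact hbd s hs
    _ = _ := by ring

end IsFundamentalOperator

end Fundamental

/-! ### Exponential dichotomy and bounded solutions of the forced linear equation -/

section Dichotomy

variable {𝕜 : Type*} [RCLike 𝕜] {X : Type*} [NormedAddCommGroup X] [NormedSpace 𝕜 X]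
  {A W : ℝ → X →L[𝕜] X} {V : ℝ → ℝ → X →L[𝕜] X} {P : X →L[𝕜] X} {K α : ℝ} {a : ℝ → ℝ}

/-- An estimate by partial summation, with the variation of the integrand in place of that of the
integrator. -/
theorem IsKurzweilPrimitive.norm_parts_le {g Q : ℝ → X} {m : ℝ → ℝ} {κ p q : ℝ}
    (hQ : IsKurzweilPrimitive (fun τ s => W s (g τ)) Q) (hg : IncrLE g m) (hpq : p ≤ q)
    (hκ : ∀ σ ∈ Icc p q, ‖W σ‖ ≤ κ) :
    ‖Q q - Q p - (W q (g q) - W p (g p))‖ ≤ κ * (m q - m p) := by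
  refine le_of_forall_pos_le_add fun ε hε => ?_
  obtain ⟨w, hw, h1, h2⟩ := hQ p q hpq ε hε
  have bound : ∀ σ ∈ Icc p q, ∀ s t, s ≤ t → ‖W σ (g t - g s)‖ ≤ κ * (m t - m s) :=
    fun σ hσ s t hst => ((W σ).le_opNorm _).trans
      (mul_le_mul (hκ σ hσ) (hg s t hst) (norm_nonneg _) ((norm_nonneg _).trans (hκ σ hσ)))
  -- Up to the defect of `Q`, the increment of `W g - Q` beside a tag is `W` at the other endpoint
  -- applied to an increment of `g`.
  have h : IsApproxPrimitive (fun _ _ => 0) (fun t => W t (g t) - Q t)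
      (fun t => κ * m t + w t) p q := by
    refine ⟨fun τ hτ => ?_, fun τ hτ => ?_⟩
    · filter_upwards [h1 τ hτ, Ioo_mem_nhdsLT hτ.1] with s hs hI
      have hb := bound s ⟨hI.1.le, hI.2.le.trans hτ.2⟩ s τ hI.2.le
      calc _ = ‖W s (g τ - g s) - (Q τ - Q s - (W τ (g τ) - W s (g τ)))‖ := by
            congr 1; rw [map_sub]; abel
        _ ≤ _ := (norm_sub_le _ _).trans (by linarith)
    · filter_upwards [h2 τ hτ, Ioo_mem_nhdsGT hτ.2] with t ht hI
      have hb := bound t ⟨hτ.1.trans hI.1.le, hI.2.le⟩ τ t hI.1.le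
      calc _ = ‖W t (g t - g τ) - (Q t - Q τ - (W t (g τ) - W τ (g τ)))‖ := by
            congr 1; rw [map_sub]; abel
        _ ≤ _ := (norm_sub_le _ _).trans (by linarith)
  have := h.norm_sub_le hpq
  calc _ = ‖W q (g q) - Q q - (W p (g p) - Q p)‖ := by rw [← norm_neg]; congr 1; abel
    _ ≤ _ := this.trans (by linarith)

theorem IncrLE.clm_comp {v : ℝ → ℝ} (hW : IncrLE W v) (L : X →L[𝕜] X) :
    IncrLE (fun t => L.comp (W t)) (fun t => ‖L‖ * v t) := fun s t hst => by
  beta_reduce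
  rw [← ContinuousLinearMap.comp_sub, ← mul_sub]
  exact (ContinuousLinearMap.opNorm_comp_le _ _).trans
    (mul_le_mul_of_nonneg_left (hW s t hst) (norm_nonneg _))

theorem HasStieltjesIntegralAtBot.unique {g : ℝ → X} {t : ℝ} {J J' : X}
    (h : HasStieltjesIntegralAtBot W g t J) (h' : HasStieltjesIntegralAtBot W g t J') :
    J = J' := by
  obtain ⟨I, hI, hJ⟩ := h
  obtain ⟨I', hI', hJ'⟩ := h'
  refine tendsto_nhds_unique hJ (hJ'.congr' ?_)
  filter_upwards [eventually_le_atBot t] with η hη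
  exact HasKurzweilIntegral.unique (hI' η hη) (hI η hη)

theorem HasStieltjesIntegralAtTop.unique {g : ℝ → X} {t : ℝ} {J J' : X}
    (h : HasStieltjesIntegralAtTop W g t J) (h' : HasStieltjesIntegralAtTop W g t J') :
    J = J' := by
  obtain ⟨I, hI, hJ⟩ := h
  obtain ⟨I', hI', hJ'⟩ := h'
  refine tendsto_nhds_unique hJ (hJ'.congr' ?_)
  filter_upwards [eventually_ge_atTop t] with η hη
  exact HasKurzweilIntegral.unique (hI' η hη) (hI η hη)

theorem tendsto_const_mul_exp_atBot (hα : 0 < α) (c t : ℝ) :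
    Tendsto (fun s => c * Real.exp (-α * (t - s))) atBot (𝓝 0) := by
  have h : Tendsto (fun s : ℝ => -α * (t - s)) atBot atBot := by
    have := tendsto_atBot_add_const_right atBot (-α * t) (tendsto_id.const_mul_atBot hα)
    refine this.congr fun s => ?_
    simp only [id]
    ring
  simpa using (Real.tendsto_exp_atBot.comp h).const_mul c

theorem tendsto_const_mul_exp_atTop (hα : 0 < α) (c t : ℝ) :
    Tendsto (fun s => c * Real.exp (α * (t - s))) atTop (𝓝 0) := by
  have h : Tendsto (fun s : ℝ => α * (t - s)) atTop atBot := by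
    have := tendsto_atBot_add_const_right atTop (α * t)
      (tendsto_id.const_mul_atTop_of_neg (neg_lt_zero.2 hα))
    refine this.congr fun s => ?_
    simp only [id]
    ring
  simpa using (Real.tendsto_exp_atBot.comp h).const_mul c

variable [CompleteSpace X]

namespace HasExponentialDichotomy

/-- The components P u(0) and (I - P)u(0) are carried from u(s) by operators that decay
exponentially as s tends to -∞ and to +∞ respectively. -/
theorem eq_zero_of_bounded (hd : HasExponentialDichotomy A V P K α) (hα : 0 < α)
    (hA : IncrLE A a) (hl : ∀ t, IsUnit (1 - (A t - Function.leftLim A t)))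
    (hr : ∀ t, IsUnit (1 + (Function.rightLim A t - A t))) {u : ℝ → X}
    (hu : IsHomogeneousSolution A u) {M : ℝ} (hM : ∀ t, ‖u t‖ ≤ M) (t : ℝ) : u t = 0 := by
  have hV := hd.fundamental
  have h00 := hV.self_eq hA 0
  have hu0 : ∀ s, u 0 = V 0 s (u s) := fun s =>
    hV.eq_apply_of_isHomogeneousSolution hA hl hr hu 0 s
  have h1 : P (u 0) = 0 := by
    rw [← norm_le_zero_iff]
    refine ge_of_tendsto (tendsto_const_mul_exp_atBot hα (M * K) 0) ?_
    filter_upwards [eventually_le_atBot 0] with s hs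
    have e : P (u 0) = (V 0 0).comp (P.comp (V 0 s)) (u s) := by simp [h00, ← hu0 s]
    rw [e, mul_assoc, mul_comm M]
    exact (ContinuousLinearMap.le_opNorm _ _).trans
      (mul_le_mul (hd.stable 0 s hs) (hM s) (norm_nonneg _)
        ((norm_nonneg _).trans (hd.stable 0 s hs)))
  have h2 : u 0 - P (u 0) = 0 := by
    rw [← norm_le_zero_iff]
    refine ge_of_tendsto (tendsto_const_mul_exp_atTop hα (M * K) 0) ?_
    filter_upwards [eventually_gt_atTop 0] with s hs
    have e : u 0 - P (u 0) =
        (V 0 0).comp ((ContinuousLinearMap.id 𝕜 X - P).comp (V 0 s)) (u s) := by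
      simp [h00, ← hu0 s]
    rw [e, mul_assoc, mul_comm M]
    exact (ContinuousLinearMap.le_opNorm _ _).trans
      (mul_le_mul (hd.unstable 0 s hs) (hM s) (norm_nonneg _)
        ((norm_nonneg _).trans (hd.unstable 0 s hs)))
  rw [h1, sub_zero] at h2
  exact hu.eq_zero hA hl hr h2 t

/-- Existence of a bounded solution of the inhomogeneous linear equation, with its integral
representation. -/
theorem exists_bounded_solution (hd : HasExponentialDichotomy A V P K α) (hK : 0 < K) (hα : 0 < α)
    (hA : IncrLE A a) (hl : ∀ t, IsUnit (1 - (A t - Function.leftLim A t)))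
    (hr : ∀ t, IsUnit (1 + (Function.rightLim A t - A t))) {g : ℝ → X} {m : ℝ → ℝ} {ρ : ℝ}
    (hg : IncrLE g m) (hm : ∀ s t, s ≤ t → m t - m s ≤ ρ) :
    ∃ x : ℝ → X, (∀ t, ‖x t‖ ≤ (2 * K + 1) * ρ) ∧
      IsKurzweilPrimitive (fun τ s => A s (x τ)) (fun t => x t - g t) ∧
      ∀ t, ∃ J₁ J₂ : X,
        HasStieltjesIntegralAtBot (fun σ => (V t 0).comp (P.comp (V 0 σ))) g t J₁ ∧
        HasStieltjesIntegralAtTop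
          (fun σ => (V t 0).comp ((ContinuousLinearMap.id 𝕜 X - P).comp (V 0 σ))) g t J₂ ∧
        x t = g t - J₁ + J₂ := by
  have hV := hd.fundamental
  have h00 := hV.self_eq hA 0
  obtain ⟨vZ, hZ⟩ := hV.exists_incrLE_inverse hA hl hr
  obtain ⟨vY, hY⟩ := exists_incrLE_of_locallyBoundedVariationOn (hV.locallyBV 0)
  set R : X →L[𝕜] X := ContinuousLinearMap.id 𝕜 X - P with hR
  have hρ : 0 ≤ ρ := by simpa using hm 0 0 le_rfl
  obtain ⟨G, hG0, hG⟩ : ∃ G, 0 ≤ G ∧ ∀ t, ‖g t‖ ≤ G := by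
    refine ⟨‖g 0‖ + ρ, by positivity, fun t => ?_⟩
    have h1 : ‖g t - g 0‖ ≤ ρ := by
      refine (hg.norm_sub_le 0 t).trans ?_
      rcases le_total 0 t with h | h
      · rw [abs_of_nonneg (sub_nonneg.2 (hg.monotone h))]
        exact hm 0 t h
      · rw [abs_of_nonpos (sub_nonpos.2 (hg.monotone h)), neg_sub]
        exact hm t 0 h
    calc ‖g t‖ = ‖g 0 + (g t - g 0)‖ := by congr 1; abel
      _ ≤ _ := (norm_add_le _ _).trans (by linarith)
  have hWP := hZ.clm_comp P
  have hWR := hZ.clm_comp R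
  obtain ⟨Q₁, -, hQ₁⟩ := exists_primitive_stieltjes hWP hg.isRegulated
  obtain ⟨Q₂, -, hQ₂⟩ := exists_primitive_stieltjes hWR hg.isRegulated
  have hTQ₁ : ∀ t, IsKurzweilPrimitive
      (fun τ s => (V t 0).comp (P.comp (V 0 s)) (g τ)) (fun s => V t 0 (Q₁ s)) :=
    fun t => hQ₁.clm_comp (V t 0)
  have hTQ₂ : ∀ t, IsKurzweilPrimitive
      (fun τ s => (V t 0).comp (R.comp (V 0 s)) (g τ)) (fun s => V t 0 (Q₂ s)) :=
    fun t => hQ₂.clm_comp (V t 0)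
  have hgb : ∀ t s, s ≤ t → ‖(V t 0).comp (P.comp (V 0 s)) (g s)‖ ≤
      (K * G) * Real.exp (-α * (t - s)) := fun t s hst =>
    ((ContinuousLinearMap.le_opNorm _ _).trans (mul_le_mul (hd.stable t s hst) (hG s)
      (norm_nonneg _) ((norm_nonneg _).trans (hd.stable t s hst)))).trans_eq (by ring)
  have hgt : ∀ t s, t < s → ‖(V t 0).comp (R.comp (V 0 s)) (g s)‖ ≤
      (K * G) * Real.exp (α * (t - s)) := fun t s hst =>
    ((ContinuousLinearMap.le_opNorm _ _).trans (mul_le_mul (hd.unstable t s hst) (hG s)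
      (norm_nonneg _) ((norm_nonneg _).trans (hd.unstable t s hst)))).trans_eq (by ring)
  -- Between `η` and `η₀` the partial summation error and the two boundary terms together are at
  -- most `K * (ρ + 2 * G)` times the exponential at `η₀`.
  obtain ⟨q₁, hq₁⟩ : ∃ q₁, Tendsto Q₁ atBot (𝓝 q₁) := by
    refine cauchy_map_iff_exists_tendsto.1 (cauchy_map_of_forall_eventually fun ε hε => ?_)
    obtain ⟨η₀, hη₀, hη₀'⟩ := (((tendsto_const_mul_exp_atBot hα (K * (ρ + 2 * G)) 0).eventually
      (gt_mem_nhds hε)).and (eventually_le_atBot 0)).exists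
    refine ⟨Q₁ η₀, ?_⟩
    filter_upwards [eventually_le_atBot η₀] with η hη
    have hexp : ∀ σ ≤ η₀, Real.exp (-α * (0 - σ)) ≤ Real.exp (-α * (0 - η₀)) := fun σ hσ =>
      Real.exp_le_exp.2 (by nlinarith)
    have h1 := (hTQ₁ 0).norm_parts_le hg hη (κ := K * Real.exp (-α * (0 - η₀))) fun σ hσ =>
      (hd.stable 0 σ (hσ.2.trans hη₀')).trans (mul_le_mul_of_nonneg_left (hexp σ hσ.2) hK.le)
    have h2 := hgb 0 η (hη.trans hη₀')
    have h3 := hgb 0 η₀ hη₀'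
    have h4 := mul_le_mul_of_nonneg_left (hexp η hη) (mul_nonneg hK.le hG0)
    have h5 := mul_le_mul_of_nonneg_left (hm η η₀ hη)
      (mul_nonneg hK.le (Real.exp_pos (-α * (0 - η₀))).le)
    rw [h00] at h1 h2 h3
    simp only [one_apply_eq_self] at h1
    set z₀ := ((1 : X →L[𝕜] X).comp (P.comp (V 0 η₀))) (g η₀)
    set z := ((1 : X →L[𝕜] X).comp (P.comp (V 0 η))) (g η)
    calc ‖Q₁ η - Q₁ η₀‖ = ‖(Q₁ η₀ - Q₁ η - (z₀ - z)) + (z₀ - z)‖ := by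
          rw [← norm_neg]; congr 1; abel
      _ ≤ _ := norm_add_le _ _
      _ ≤ _ := add_le_add_right (norm_sub_le _ _) _
      _ ≤ ε := by linarith
  obtain ⟨q₂, hq₂⟩ : ∃ q₂, Tendsto Q₂ atTop (𝓝 q₂) := by
    refine cauchy_map_iff_exists_tendsto.1 (cauchy_map_of_forall_eventually fun ε hε => ?_)
    obtain ⟨η₀, hη₀, hη₀'⟩ := (((tendsto_const_mul_exp_atTop hα (K * (ρ + 2 * G)) 0).eventually
      (gt_mem_nhds hε)).and (eventually_gt_atTop 0)).exists
    refine ⟨Q₂ η₀, ?_⟩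
    filter_upwards [eventually_ge_atTop η₀] with η hη
    have hexp : ∀ σ ≥ η₀, Real.exp (α * (0 - σ)) ≤ Real.exp (α * (0 - η₀)) := fun σ hσ =>
      Real.exp_le_exp.2 (by nlinarith)
    have h1 := (hTQ₂ 0).norm_parts_le hg hη (κ := K * Real.exp (α * (0 - η₀))) fun σ hσ =>
      (hd.unstable 0 σ (hη₀'.trans_le hσ.1)).trans
        (mul_le_mul_of_nonneg_left (hexp σ hσ.1) hK.le)
    have h2 := hgt 0 η (hη₀'.trans_le hη)
    have h3 := hgt 0 η₀ hη₀'
    have h4 := mul_le_mul_of_nonneg_left (hexp η hη) (mul_nonneg hK.le hG0)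
    have h5 := mul_le_mul_of_nonneg_left (hm η₀ η hη)
      (mul_nonneg hK.le (Real.exp_pos (α * (0 - η₀))).le)
    rw [h00] at h1 h2 h3
    simp only [one_apply_eq_self] at h1
    set z₀ := ((1 : X →L[𝕜] X).comp (R.comp (V 0 η₀))) (g η₀)
    set z := ((1 : X →L[𝕜] X).comp (R.comp (V 0 η))) (g η)
    calc ‖Q₂ η - Q₂ η₀‖ = ‖(Q₂ η - Q₂ η₀ - (z - z₀)) + (z - z₀)‖ := by congr 1; abel
      _ ≤ _ := norm_add_le _ _
      _ ≤ _ := add_le_add_right (norm_sub_le _ _) _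
      _ ≤ ε := by linarith
  -- The two terms after `g t` are the improper integrals. Together they equal `V t 0 (c - Q t)`
  -- with `Q = Q₁ + Q₂` and `c = q₁ + q₂`, the form used in variation of constants.
  refine ⟨fun t => g t - V t 0 (Q₁ t - q₁) + V t 0 (q₂ - Q₂ t), fun t => ?_, ?_, fun t =>
    ⟨V t 0 (Q₁ t - q₁), V t 0 (q₂ - Q₂ t), ⟨fun η => V t 0 (Q₁ t) - V t 0 (Q₁ η),
      fun η _ => (hTQ₁ t).hasKurzweilIntegral η t, ?_⟩,
      ⟨fun η => V t 0 (Q₂ η) - V t 0 (Q₂ t),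
      fun η _ => (hTQ₂ t).hasKurzweilIntegral t η, ?_⟩, rfl⟩⟩
  · have hPR : (V t 0).comp (P.comp (V 0 t)) (g t) + (V t 0).comp (R.comp (V 0 t)) (g t) =
        g t := by
      simp [hR, hV.apply_apply hA hl hr]
    have hPR' : (V t 0).comp (P.comp (V 0 t)) + (V t 0).comp (R.comp (V 0 t)) = 1 := by
      ext ξ
      simp [hR, hV.apply_apply hA hl hr]
    have b₁ : ‖V t 0 (Q₁ t) - V t 0 q₁ - ((V t 0).comp (P.comp (V 0 t)) (g t) - 0)‖ ≤ K * ρ := by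
      have hlim : Tendsto (fun η => (V t 0).comp (P.comp (V 0 η)) (g η)) atBot (𝓝 0) :=
        squeeze_zero_norm' ((eventually_le_atBot t).mono fun η hη => hgb t η hη)
          (tendsto_const_mul_exp_atBot hα (K * G) t)
      refine le_of_tendsto ((((((V t 0).continuous.tendsto _).comp hq₁).const_sub _).sub
        (hlim.const_sub _)).norm) ?_
      · filter_upwards [eventually_le_atBot t] with η hη
        refine ((hTQ₁ t).norm_parts_le hg hη (κ := K) fun σ hσ =>
          (hd.stable t σ hσ.2).trans ?_).trans (mul_le_mul_of_nonneg_left (hm η t hη) hK.le)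
        exact mul_le_of_le_one_right hK.le (Real.exp_le_one_iff.2 (by nlinarith [hσ.2]))
    have b₂ : ‖V t 0 q₂ - V t 0 (Q₂ t) - (0 - (V t 0).comp (R.comp (V 0 t)) (g t))‖ ≤
        (K + 1) * ρ := by
      have hlim : Tendsto (fun η => (V t 0).comp (R.comp (V 0 η)) (g η)) atTop (𝓝 0) :=
        squeeze_zero_norm' ((eventually_gt_atTop t).mono fun η hη => hgt t η hη)
          (tendsto_const_mul_exp_atTop hα (K * G) t)
      refine le_of_tendsto ((((((V t 0).continuous.tendsto _).comp hq₂).sub_const _).sub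
        (hlim.sub_const _)).norm) ?_
      · filter_upwards [eventually_ge_atTop t] with η hη
        refine ((hTQ₂ t).norm_parts_le hg hη (κ := K + 1) fun σ hσ => ?_).trans
          (mul_le_mul_of_nonneg_left (hm t η hη) (by positivity))
        -- The unstable bound holds only for `t < σ`. On the diagonal the operator is `I` minus the
        -- stable one, of norm at most `K + 1`; hence the bound `2 * K + 1` in total.
        rcases hσ.1.eq_or_lt with rfl | hlt
        · rw [eq_sub_of_add_eq' hPR']
          have h1 : ‖(1 : X →L[𝕜] X)‖ ≤ 1 := ContinuousLinearMap.norm_id_le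
          have h2 := hd.stable t t le_rfl
          rw [sub_self, mul_zero, Real.exp_zero, mul_one] at h2
          exact (norm_sub_le _ _).trans (by linarith)
        · have h1 : K * Real.exp (α * (t - σ)) ≤ K :=
            mul_le_of_le_one_right hK.le (Real.exp_le_one_iff.2 (by nlinarith))
          exact (hd.unstable t σ hlt).trans (by linarith)
    set z₁ := (V t 0).comp (P.comp (V 0 t)) (g t)
    set z₂ := (V t 0).comp (R.comp (V 0 t)) (g t)
    calc _ = ‖(V t 0 q₂ - V t 0 (Q₂ t) - (0 - z₂)) - (V t 0 (Q₁ t) - V t 0 q₁ - (z₁ - 0))‖ := by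
          congr 1
          beta_reduce
          rw [map_sub, map_sub, ← hPR]
          abel
      _ ≤ _ := (norm_sub_le _ _).trans (by linarith)
  · have hQ : IsKurzweilPrimitive (fun τ s => V 0 s (g τ)) (fun t => Q₁ t + Q₂ t) := by
      convert hQ₁.add hQ₂ using 3
      simp [hR]
    have hQv := hQ.incrLE fun τ => hZ.clm_apply (hG τ)
    have := IsKurzweilPrimitive.variation_of_constants hY hZ hg hQv
      (fun t ξ => hV.apply_apply hA hl hr t 0 ξ)
      (hV.isKurzweilPrimitive hA 0) hQ (q₁ + q₂)
    convert this using 1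
    · funext τ s
      congr 1
      simp only [map_sub, map_add]
      abel
    · funext t
      simp only [map_sub, map_add]
      abel
  · rw [map_sub]
    exact (((V t 0).continuous.tendsto _).comp hq₁).const_sub _
  · rw [map_sub]
    exact (((V t 0).continuous.tendsto _).comp hq₂).sub_const _

theorem eq_of_bounded (hd : HasExponentialDichotomy A V P K α) (hα : 0 < α)
    (hA : IncrLE A a) (hl : ∀ t, IsUnit (1 - (A t - Function.leftLim A t)))
    (hr : ∀ t, IsUnit (1 + (Function.rightLim A t - A t))) {g x x' : ℝ → X} {M M' : ℝ}
    (hM : ∀ t, ‖x t‖ ≤ M) (hM' : ∀ t, ‖x' t‖ ≤ M')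
    (hx : IsKurzweilPrimitive (fun τ s => A s (x τ)) (fun t => x t - g t))
    (hx' : IsKurzweilPrimitive (fun τ s => A s (x' τ)) (fun t => x' t - g t)) : x = x' := by
  funext t
  have hu : IsKurzweilPrimitive (fun τ s => A s (x τ - x' τ)) (fun t => x t - x' t) := by
    simpa only [map_sub, sub_sub_sub_cancel_right] using hx.sub hx'
  have hb : ∀ t, ‖x t - x' t‖ ≤ M + M' := fun t =>
    (norm_sub_le _ _).trans (add_le_add (hM t) (hM' t))
  exact sub_eq_zero.1 (hd.eq_zero_of_bounded hα hA hl hr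
    ⟨⟨_, hu.incrLE fun τ => hA.clm_apply (hb τ)⟩, hu⟩ hb t)

end HasExponentialDichotomy

end Dichotomy

/-! ### The nonlinear equation: integral formula and contraction -/

section Nonlinear

variable {𝕜 : Type*} [RCLike 𝕜] {X : Type*} [NormedAddCommGroup X] [NormedSpace 𝕜 X]
  {A : ℝ → X →L[𝕜] X} {V : ℝ → ℝ → X →L[𝕜] X} {P : X →L[𝕜] X} {K α : ℝ} {a : ℝ → ℝ}
  {F : X → ℝ → X} {h : ℝ → ℝ}

theorem sub_le_of_supVariation_le {δ : ℝ≥0} (hδ : supVariation h ≤ δ) {s t : ℝ} (hst : s ≤ t) :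
    h t - h s ≤ δ := by
  rcases hst.eq_or_lt with rfl | hlt
  · simp
  · have h1 : edist (h t) (h s) ≤ δ :=
      (eVariationOn.edist_le h (right_mem_Icc.2 hst) (left_mem_Icc.2 hst)).trans
        (le_trans (le_iSup_of_le s (le_iSup_of_le t
          (le_iSup (fun _ : s < t => eVariationOn h (Icc s t)) hlt))) hδ)
    have h2 : dist (h t) (h s) ≤ δ := by
      rw [dist_edist]
      exact ENNReal.toReal_le_coe_of_le_coe h1
    exact (le_abs_self _).trans h2

namespace IsInClassF

theorem incrLE (hF : IsInClassF F h) (x : X) : IncrLE (F x) h := fun s t hst =>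
  (hF.bound x s t).trans_eq (abs_of_nonneg (sub_nonneg.2 (hF.mono hst)))

theorem norm_sub_sub_le (hF : IsInClassF F h) (x z : X) {s t : ℝ} (hst : s ≤ t) :
    ‖F x t - F x s - (F z t - F z s)‖ ≤ ‖x - z‖ * (h t - h s) := by
  have := hF.lipschitz x z s t
  rw [abs_of_nonneg (sub_nonneg.2 (hF.mono hst))] at this
  refine le_of_eq_of_le ?_ this
  congr 1
  abel

theorem exists_primitive [CompleteSpace X] (hF : IsInClassF F h) {x : ℝ → X}
    (hx : IsRegulated x) : ∃ g, g 0 = 0 ∧ IsKurzweilPrimitive (fun τ s => F (x τ) s) g :=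
  exists_primitive_of_isRegulated hF.mono hx fun τ τ' _ _ hst =>
    hF.norm_sub_sub_le (x τ) (x τ') hst

/-- Nothing is known yet about `x`, so integrability on `[s, t]` cannot be used. Integrals sharing
the endpoint 0 are compared through their sums instead. -/
theorem incrLE_of_hasKurzweilIntegral (hF : IsInClassF F h) {x g : ℝ → X}
    (hg : ∀ σ, HasKurzweilIntegral (fun τ s => F (x τ) s) 0 σ (g σ)) : IncrLE g h := by
  intro s t hst
  have hU : ∀ τ, IncrLE (F (x τ)) h := fun τ => hF.incrLE (x τ)
  rcases le_or_gt 0 s with hs | hs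
  · exact ((hg s).1 hs).norm_sub_le_of_left ((hg t).1 (hs.trans hst)) hs hst hU
  · have h1 := (hg s).2 hs
    rcases le_or_gt 0 t with ht | ht
    · have h2 := h1.norm_le hs.le fun τ _ => hU τ
      have h3 := ((hg t).1 ht).norm_le ht fun τ _ => hU τ
      rw [norm_neg] at h2
      exact (norm_sub_le _ _).trans (by linarith)
    · have h2 := ((hg t).2 ht).norm_sub_le_of_right h1 hst ht.le hU
      rwa [neg_sub_neg] at h2

end IsInClassF

theorem IsKurzweilPrimitive.incrLE_add {x g : ℝ → X} {M : ℝ}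
    (hx : IsKurzweilPrimitive (fun τ s => A s (x τ)) (fun t => x t - g t)) (hA : IncrLE A a)
    (hM : ∀ t, ‖x t‖ ≤ M) (hg : IncrLE g h) : IncrLE x (fun t => M * a t + h t) := by
  simpa only [sub_add_cancel] using (hx.incrLE fun τ => hA.clm_apply (hM τ)).add hg

theorem isGODESolution_of_primitive {x g : ℝ → X}
    (hg : IsKurzweilPrimitive (fun τ s => F (x τ) s) g)
    (hx : IsKurzweilPrimitive (fun τ s => A s (x τ)) (fun t => x t - g t)) :
    IsGODESolution A F x := fun p q => by
  simpa only [sub_add_cancel] using (hx.add hg).hasKurzweilIntegral p q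

variable [CompleteSpace X]

/-- Boundedness makes `x` locally of bounded variation, hence regulated. Then the linear and
nonlinear parts are integrable separately and the joint integral splits. -/
theorem IsGODESolution.exists_primitive {x : ℝ → X} (hx : IsGODESolution A F x) {M : ℝ}
    (hM : ∀ t, ‖x t‖ ≤ M) (hA : IncrLE A a) (hF : IsInClassF F h) :
    ∃ g, g 0 = 0 ∧ IsKurzweilPrimitive (fun τ s => F (x τ) s) g ∧
      IsKurzweilPrimitive (fun τ s => A s (x τ)) (fun t => x t - g t) := by
  have hxv : IncrLE x (fun t => M * a t + h t) := fun s t hst =>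
    ((hx s t).1 hst).norm_le hst fun τ _ => (hA.clm_apply (hM τ)).add (hF.incrLE (x τ))
  obtain ⟨g, hg0, hg⟩ := hF.exists_primitive hxv.isRegulated
  obtain ⟨k, -, hk⟩ := exists_primitive_stieltjes hA hxv.isRegulated
  have := (hk.add hg).of_hasKurzweilIntegralOn fun p q hpq => (hx p q).1 hpq
  refine ⟨g, hg0, hg, ?_⟩
  simpa only [add_sub_cancel_right] using this.sub hg

variable (hd : HasExponentialDichotomy A V P K α) (hK : 0 < K) (hα : 0 < α) (hA : IncrLE A a)
  (hl : ∀ t, IsUnit (1 - (A t - Function.leftLim A t)))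
  (hr : ∀ t, IsUnit (1 + (Function.rightLim A t - A t)))
  (hF : IsInClassF F h) {δ : ℝ} (hδ : ∀ s t, s ≤ t → h t - h s ≤ δ)

include hd hK hα hA hl hr hF hδ

theorem satisfiesBoundedFormula_of_primitive {x g : ℝ → X} {M : ℝ} (hM : ∀ t, ‖x t‖ ≤ M)
    (hg0 : g 0 = 0) (hg : IsKurzweilPrimitive (fun τ s => F (x τ) s) g)
    (hx : IsKurzweilPrimitive (fun τ s => A s (x τ)) (fun t => x t - g t)) :
    SatisfiesBoundedFormula V P F x := by
  refine ⟨g, fun σ => by simpa [hg0] using hg.hasKurzweilIntegral 0 σ, ?_⟩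
  obtain ⟨y, hyM, hy, hyJ⟩ := hd.exists_bounded_solution hK hα hA hl hr
    (hg.incrLE fun τ => hF.incrLE (x τ)) hδ
  rwa [hd.eq_of_bounded hα hA hl hr hM hyM hx hy]

/-- By uniqueness of the integrals `x` is the bounded linear solution `y` forced by `g`. Its
regularity then shows that `g` is a primitive. -/
theorem isGODESolution_of_satisfiesBoundedFormula {x : ℝ → X}
    (hx : SatisfiesBoundedFormula V P F x) : IsGODESolution A F x := by
  obtain ⟨g, hg, hxJ⟩ := hx
  have hgh := hF.incrLE_of_hasKurzweilIntegral hg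
  obtain ⟨y, hyM, hy, hyJ⟩ := hd.exists_bounded_solution hK hα hA hl hr hgh hδ
  obtain rfl : x = y := by
    funext t
    obtain ⟨J₁, J₂, h₁, h₂, e⟩ := hxJ t
    obtain ⟨J₁', J₂', h₁', h₂', e'⟩ := hyJ t
    rw [e, e', h₁.unique h₁', h₂.unique h₂']
  obtain ⟨g', hg0, hg'⟩ := hF.exists_primitive (hy.incrLE_add hA hyM hgh).isRegulated
  obtain rfl : g' = g := by
    funext σ
    simpa [hg0] using (hg'.hasKurzweilIntegral 0 σ).unique (hg σ)
  exact isGODESolution_of_primitive hg' hy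

/-- The solution operator of the linear equation with forcing `∫ DF(z(τ), s)` is Lipschitz. -/
theorem norm_sub_le_of_primitive {x x' g g' z z' : ℝ → X} {M M' D : ℝ} (hM : ∀ t, ‖x t‖ ≤ M)
    (hM' : ∀ t, ‖x' t‖ ≤ M') (hD : ∀ t, ‖z t - z' t‖ ≤ D)
    (hg : IsKurzweilPrimitive (fun τ s => F (z τ) s) g)
    (hg' : IsKurzweilPrimitive (fun τ s => F (z' τ) s) g')
    (hx : IsKurzweilPrimitive (fun τ s => A s (x τ)) (fun t => x t - g t))
    (hx' : IsKurzweilPrimitive (fun τ s => A s (x' τ)) (fun t => x' t - g' t)) (t : ℝ) :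
    ‖x t - x' t‖ ≤ (2 * K + 1) * (D * δ) := by
  have hD0 : 0 ≤ D := (norm_nonneg _).trans (hD 0)
  have hgg : IncrLE (fun t => g t - g' t) (fun t => D * h t) := by
    refine (hg.sub hg').incrLE fun τ s t hst => ?_
    beta_reduce
    rw [← mul_sub]
    refine le_trans (le_of_eq_of_le ?_ (hF.norm_sub_sub_le (z τ) (z' τ) hst))
      (mul_le_mul_of_nonneg_right (hD τ) (sub_nonneg.2 (hF.mono hst)))
    congr 1
    abel
  obtain ⟨y, hyM, hy, -⟩ := hd.exists_bounded_solution hK hα hA hl hr (ρ := D * δ) hgg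
    fun s t hst => by
      rw [← mul_sub]
      exact mul_le_mul_of_nonneg_left (hδ s t hst) hD0
  have hxx : IsKurzweilPrimitive (fun τ s => A s (x τ - x' τ))
      (fun t => (x t - x' t) - (g t - g' t)) := by
    simpa only [map_sub, sub_sub_sub_comm] using hx.sub hx'
  have := hd.eq_of_bounded hα hA hl hr (x := fun t => x t - x' t)
    (fun t => (norm_sub_le _ _).trans (add_le_add (hM t) (hM' t))) hyM hxx hy
  exact (congrArg norm (congrFun this t)).trans_le (hyM t)

theorem eq_of_bounded_of_isGODESolution (hδ1 : (2 * K + 1) * δ ≤ 1 / 2) {x x' : ℝ → X} {M M' : ℝ}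
    (hM : ∀ t, ‖x t‖ ≤ M) (hM' : ∀ t, ‖x' t‖ ≤ M') (hx : IsGODESolution A F x)
    (hx' : IsGODESolution A F x') : x = x' := by
  obtain ⟨g, -, hg, hx⟩ := hx.exists_primitive hM hA hF
  obtain ⟨g', -, hg', hx'⟩ := hx'.exists_primitive hM' hA hF
  have hb : BddAbove (range fun t => ‖x t - x' t‖) :=
    ⟨M + M', by rintro _ ⟨t, rfl⟩; exact (norm_sub_le _ _).trans (add_le_add (hM t) (hM' t))⟩
  set D := ⨆ t, ‖x t - x' t‖ with hDdef
  have hD : ∀ t, ‖x t - x' t‖ ≤ D := fun t => le_ciSup hb t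
  have hD0 : 0 ≤ D := (norm_nonneg _).trans (hD 0)
  have h1 : D ≤ (2 * K + 1) * (D * δ) := ciSup_le fun t =>
    norm_sub_le_of_primitive hd hK hα hA hl hr hF hδ hM hM' hD hg hg' hx hx' t
  -- The previous bound says `D ≤ D / 2`.
  have h2 : D ≤ 0 := by nlinarith
  funext t
  exact sub_eq_zero.1 (norm_le_zero_iff.1 ((hD t).trans h2))

theorem exists_bounded_isGODESolution (hδ1 : (2 * K + 1) * δ ≤ 1 / 2) :
    ∃ x : ℝ → X, (∃ M : ℝ, ∀ t, ‖x t‖ ≤ M) ∧ IsGODESolution A F x := by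
  -- Regulated functions are used because the forcing integral exists for each of them and uniform
  -- limits preserve them.
  let S : Set (lp (fun _ : ℝ => X) ∞) := {f | IsRegulated f}
  have hS : IsClosed S := by
    refine isClosed_of_closure_subset fun f hf => isRegulated_of_approx fun ε hε => ?_
    obtain ⟨y, hy, hfy⟩ := Metric.mem_closure_iff.1 hf ε hε
    refine ⟨y, hy, fun t => ?_⟩
    rw [dist_eq_norm] at hfy
    exact (lp.norm_apply_le_norm ENNReal.top_ne_zero (f - y) t).trans hfy.le
  have : CompleteSpace S := hS.completeSpace_coe
  have : Nonempty S := ⟨⟨0, fun τ ε hε => by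
    constructor <;> exact ⟨0, Eventually.of_forall fun t => by simpa using hε.le⟩⟩⟩
  have H : ∀ f : S, ∃ (y : S) (g : ℝ → X), g 0 = 0 ∧
      IsKurzweilPrimitive (fun τ s => F (f.1 τ) s) g ∧
      IsKurzweilPrimitive (fun τ s => A s (y.1 τ)) (fun t => y.1 t - g t) := by
    intro f
    obtain ⟨g, hg0, hg⟩ := hF.exists_primitive f.2
    have hgh := hg.incrLE fun τ => hF.incrLE (f.1 τ)
    obtain ⟨y, hyM, hy, -⟩ := hd.exists_bounded_solution hK hα hA hl hr hgh hδ
    have hmem : Memℓp y ∞ := memℓp_infty ⟨_, by rintro _ ⟨t, rfl⟩; exact hyM t⟩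
    exact ⟨⟨⟨y, hmem⟩, (hy.incrLE_add hA hyM hgh).isRegulated⟩, g, hg0, hg, hy⟩
  choose T g hg0 hg hT using H
  have hbd : ∀ (f : S) t, ‖f.1 t‖ ≤ ‖f.1‖ := fun f t =>
    lp.norm_apply_le_norm ENNReal.top_ne_zero f.1 t
  have hcontr : ContractingWith (1 / 2) T := by
    refine ⟨by rw [← NNReal.coe_lt_coe]; norm_num, LipschitzWith.of_dist_le_mul fun f f' => ?_⟩
    rw [Subtype.dist_eq, Subtype.dist_eq, dist_eq_norm, dist_eq_norm]
    have hn := norm_nonneg (f.1 - f'.1)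
    refine lp.norm_le_of_forall_le (by positivity) fun t => ?_
    have h1 := norm_sub_le_of_primitive hd hK hα hA hl hr hF hδ (hbd (T f)) (hbd (T f'))
      (fun t => lp.norm_apply_le_norm ENNReal.top_ne_zero (f.1 - f'.1) t)
      (hg f) (hg f') (hT f) (hT f') t
    refine h1.trans ?_
    have : ((1 / 2 : ℝ≥0) : ℝ) = 1 / 2 := by norm_num
    rw [this]
    nlinarith
  set f := hcontr.fixedPoint T
  have hf : T f = f := hcontr.fixedPoint_isFixedPt
  refine ⟨f.1, ⟨_, hbd f⟩, isGODESolution_of_primitive (hg f) ?_⟩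
  have := hT f
  rwa [hf] at this

end Nonlinear

/-! ### The main theorem -/

theorem theorem3p1 (K α C : ℝ) (VA : ℝ≥0) (hK : 0 < K) (hα : 0 < α) (hC : 0 < C) :
    ∃ δ : ℝ≥0, 0 < δ ∧
      ∀ (𝕜 : Type*) [RCLike 𝕜] (X : Type*) [NormedAddCommGroup X] [NormedSpace 𝕜 X]
        [CompleteSpace X] (A : ℝ → X →L[𝕜] X) (V : ℝ → ℝ → X →L[𝕜] X) (P : X →L[𝕜] X)
        (F : X → ℝ → X) (h : ℝ → ℝ),
        HasExponentialDichotomy A V P K α →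
        HasBoundedJumpInverses A C →
        unitVariation A ≤ VA →
        IsInClassF F h →
        supVariation h ≤ δ →
        (∃! x : ℝ → X, (∃ M : ℝ, ∀ t, ‖x t‖ ≤ M) ∧ IsGODESolution A F x) ∧
        ∀ x : ℝ → X, (∃ M : ℝ, ∀ t, ‖x t‖ ≤ M) →
          (IsGODESolution A F x ↔ SatisfiesBoundedFormula V P F x) := by
  -- With this `δ` the Lipschitz constant `(2 * K + 1) * δ` of the solution operator is 1/2.
  have hδ0 : 0 < 1 / (2 * (2 * K + 1)) := by positivity
  refine ⟨⟨_, hδ0.le⟩, hδ0, ?_⟩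
  intro 𝕜 _ X _ _ _ A V P F h hd hJ hVA hF hh
  obtain ⟨a, hA⟩ := exists_incrLE_of_locallyBoundedVariationOn
    (locallyBoundedVariationOn_of_unitVariation_lt_top (hVA.trans_lt ENNReal.coe_lt_top))
  have hδ : ∀ s t, s ≤ t → h t - h s ≤ 1 / (2 * (2 * K + 1)) := fun s t hst =>
    sub_le_of_supVariation_le hh hst
  have hδ1 : (2 * K + 1) * (1 / (2 * (2 * K + 1))) ≤ 1 / 2 := by
    apply le_of_eq
    field_simp
  have hl := hJ.left_isUnit
  have hr := hJ.right_isUnit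
  refine ⟨?_, fun x ⟨M, hM⟩ => ⟨fun hx => ?_, fun hx =>
    isGODESolution_of_satisfiesBoundedFormula hd hK hα hA hl hr hF hδ hx⟩⟩
  · obtain ⟨x, ⟨M, hM⟩, hx⟩ := exists_bounded_isGODESolution hd hK hα hA hl hr hF hδ hδ1
    refine ⟨x, ⟨⟨M, hM⟩, hx⟩, fun y ⟨⟨M', hM'⟩, hy⟩ => ?_⟩
    exact eq_of_bounded_of_isGODESolution hd hK hα hA hl hr hF hδ hδ1 hM' hM hy hx
  · obtain ⟨g, hg0, hg, hxg⟩ := hx.exists_primitive hM hA hF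
    exact satisfiesBoundedFormula_of_primitive hd hK hα hA hl hr hF hδ hM hg0 hg hxg
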